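/- For $q\in(0,1)$ let $\mathrm{Geo}(q)$ be the distribution on $\{0,1,2,\dots\}$ with weights $(1-q)q^x$, and let $M_n$ ($n\ge 0$) be its orthonormal polynomials, $M_n$ having degree $n$ and leading coefficient $\kappa_n>0$. For $N\ge 1$, the $N\times N$ Meixner ensemble is the determinantal point process $\{\lambda_1,\dots,\lambda_N\}$ on $\{0,1,2,\dots\}$ with kernel, with respect to $\mathrm{Geo}(q)$, $$K_N(x,y)=\frac{\kappa_{N-1}}{\kappa_N}\cdot\frac{M_N(x)M_{N-1}(y)-M_{N-1}(x)M_N(y)}{x-y},$$ where the value at $x=y$ is defined by taking the limit. Let $\nu_{q,N}=\mathbb{E}\bigl[\frac1N\sum_{i=1}^N\delta_{\lambda_i}\bigr]$ be its expected empirical distribution, and let $\mu_q=(1+q^{1/2})^2/(1-q)$. Theorem. For every $W>0$ there exist positive constants $C_W$, $N_0$ and $k_0$ such that for all integers $N\ge N_0$ and $k$ with $k_0\le k\le WN^{2/3}$, and all $q\in[k^{-2},1)$, the factorial moment $M^q(k,N):=\mathbb{E}[X(X-1)\cdots(X-k+1)]$ of $X\sim\nu_{q,N}$ is finite and satisfies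 $$C_W^{-1}\,(q^{1/6}k)^{-3/2}(\mu_qN)^k\exp\Bigl(-\frac{k^2}{2\mu_qN}\Bigr)\le M^q(k,N)\le C_W\,(q^{1/6}k)^{-3/2}(\mu_qN)^k\exp\Bigl(-\frac{k^2}{2\mu_qN}\Bigr).$$ -/

import Mathlib

open MeasureTheory ProbabilityTheory Polynomial
open scoped ENNReal

noncomputable section

namespace Meixner

/-- The geometric distribution `Geo(q)` on `{0, 1, 2, …}`, with weights `(1 - q) q ^ x`
(`q` is the failure probability, so the success probability is `1 - q`). -/
def geo (q : unitInterval) : Measure ℕ := geometricMeasure (unitInterval.symm q)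

/-- The inner product `⟨f, g⟩ = ∑ₓ f(x) g(x) (1 - q) q ^ x` of two polynomials in `L²(Geo(q))`. -/
def polyInner (q : unitInterval) (f g : ℝ[X]) : ℝ :=
  ∫ x : ℕ, f.eval (x : ℝ) * g.eval (x : ℝ) ∂(geo q)

/-- The monic orthogonal polynomials of `Geo(q)`: Gram–Schmidt applied to `1, X, X ^ 2, …`. -/
def monicPoly (q : unitInterval) (n : ℕ) : ℝ[X] :=
  X ^ n - ∑ m : Fin n,
    C (polyInner q (X ^ n) (monicPoly q m) / polyInner q (monicPoly q m) (monicPoly q m)) *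
      monicPoly q m
termination_by n
decreasing_by exact m.isLt

/-- The orthonormal polynomials `M_n` of `Geo(q)`, of degree `n`, with positive leading
coefficient. -/
def orthoPoly (q : unitInterval) (n : ℕ) : ℝ[X] :=
  C (1 / √(polyInner q (monicPoly q n) (monicPoly q n))) * monicPoly q n

/-- The quotient `(M_N(x) M_{N-1}(y) - M_{N-1}(x) M_N(y)) / (x - y)` for real `x`, `y`; on the
diagonal it is the limit, written with derivatives (see `tendsto_cdQuotient`). -/
def cdQuotient (q : unitInterval) (N : ℕ) (x y : ℝ) : ℝ :=
  open Classical in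
  if x = y then
    (derivative (orthoPoly q N)).eval x * (orthoPoly q (N - 1)).eval x -
      (derivative (orthoPoly q (N - 1))).eval x * (orthoPoly q N).eval x
  else
    ((orthoPoly q N).eval x * (orthoPoly q (N - 1)).eval y -
      (orthoPoly q (N - 1)).eval x * (orthoPoly q N).eval y) / (x - y)

/-- The kernel of the Meixner ensemble,
`K_N(x, y) = (κ_{N-1} / κ_N) (M_N(x) M_{N-1}(y) - M_{N-1}(x) M_N(y)) / (x - y)`,
where `κ_n` is the leading coefficient of `M_n`. -/
def kernel (q : unitInterval) (N : ℕ) (x y : ℕ) : ℝ :=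
  (orthoPoly q (N - 1)).leadingCoeff / (orthoPoly q N).leadingCoeff * cdQuotient q N x y

/-- The diagonal value of `cdQuotient` is the limit of its off-diagonal values. -/
theorem tendsto_cdQuotient (q : unitInterval) (N : ℕ) (x : ℝ) :
    Filter.Tendsto (fun y => cdQuotient q N y x) (nhdsWithin x {x}ᶜ)
      (nhds (cdQuotient q N x x)) := by
  set f := orthoPoly q N
  set g := orthoPoly q (N - 1)
  have h : HasDerivAt (fun y => f.eval y * g.eval x - g.eval y * f.eval x)
      (f.derivative.eval x * g.eval x - g.derivative.eval x * f.eval x) x :=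
    ((f.hasDerivAt x).mul_const _).sub ((g.hasDerivAt x).mul_const _)
  have h2 := h.tendsto_slope
  have e : cdQuotient q N x x =
      f.derivative.eval x * g.eval x - g.derivative.eval x * f.eval x := by
    simp [cdQuotient, f, g]
  rw [e]
  refine h2.congr' ?_
  filter_upwards [self_mem_nhdsWithin] with y hy
  have hy' : y ≠ x := hy
  simp only [slope_def_field, cdQuotient, if_neg hy', f, g]
  ring

/-- A random configuration of `N` points `(l 0, …, l (N - 1))` of the discrete space `ℕ`, with law
`Q`, is a determinantal point process with kernel `K` with respect to the reference measure `μ`: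
for every `r`, its `r`-th factorial moment measure has density `det (K(x_i, x_j))` with respect
to `μ ^ r`. The factorial moment measure of `{(x_1, …, x_r)}` is the expected number of ways to pick
particles with `r` distinct labels that sit at the positions `x_1, …, x_r` in this order. -/
def IsDeterminantal {N : ℕ} (K : ℕ → ℕ → ℝ) (μ : Measure ℕ) (Q : Measure (Fin N → ℕ)) : Prop :=
  ∀ (r : ℕ) (x : Fin r → ℕ),
    ∫⁻ l, (Nat.card {e : Fin r ↪ Fin N // ∀ j, l (e j) = x j} : ℝ≥0∞) ∂Q =
      ENNReal.ofReal (Matrix.of fun i j => K (x i) (x j)).det * ∏ j, μ {x j}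

/-- `Q` is the law of `N` points `(λ_1, …, λ_N)`, enumerated in some order (for instance in
decreasing order), of the `N × N` Meixner ensemble with parameter `q`: the determinantal point
process on `ℕ` with kernel `K_N` with respect to `Geo(q)`. -/
structure IsEnsemble (q : unitInterval) (N : ℕ) (Q : Measure (Fin N → ℕ)) : Prop where
  isProbabilityMeasure : IsProbabilityMeasure Q
  isDeterminantal : IsDeterminantal (kernel q N) (geo q) Q

/-- The expected empirical distribution `𝔼[(1/N) ∑ᵢ δ_{λᵢ}]` of a random configuration
`(λ_1, …, λ_N)` with law `Q`. -/
def meanEmpirical {N : ℕ} (Q : Measure (Fin N → ℕ)) : Measure ℕ :=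
  Q.bind fun l => (N : ℝ≥0∞)⁻¹ • ∑ i, Measure.dirac (l i)

/-- `μ_q = (1 + q^{1/2})² / (1 - q)`. -/
def edge (q : ℝ) : ℝ := (1 + √q) ^ 2 / (1 - q)

/-- The size `(q^{1/6} k)^{-3/2} (μ_q N)^k exp(-k² / (2 μ_q N))`. -/
def momentSize (q : ℝ) (N k : ℕ) : ℝ :=
  (q ^ (1 / 6 : ℝ) * k) ^ (-(3 / 2) : ℝ) * (edge q * N) ^ k *
    Real.exp (-((k : ℝ) ^ 2 / (2 * edge q * N)))

end Meixner

end

/-! Only the one-point function matters. By Christoffel–Darboux the diagonal of the kernel is a sum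
of squares of the orthonormal polynomials, so `N` times the moment is the sum over `n < N` of the
factorial moments of `M_n ^ 2` under Geo(q). The falling factorial kills `x < k`, and after `x = y +
k` it turns the geometric weight into a multiple of the negative binomial weight `(y + k).choose k *
q ^ y`. The shifted Meixner polynomial expands in the orthogonal polynomials of that weight
(`meixner_shift_iterate`), with coefficients `k.choose p * (-1/q) ^ p`. Orthogonality
(`tsum_meixner_mul`) and a hockey-stick summation over `n` give Ledoux's formula, a finite sum of
nonnegative terms (`hasSum_descFactorial_meanEmpirical`).

For its size, `∏ (N - i + j)` is `N ^ (k + 1) * exp ((k + 1) (k - 2 i) / (2 N))` up to a factor `exp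
(O(k³/N²))`, which is bounded because `k ≤ W N ^ (2/3)`. The exponent is linear in `i`, so, after `i
↦ k - i`, what remains is `exp (-s k) ∑ (k.choose i)² ρ ^ (2 i)` with `s = (k + 1) / (2 N)` and `ρ =
√q * exp s`. The sum has order `(1 + ρ) ^ (2 k) / √(k ρ)` once `k ρ ≥ 1`, and `q ≥ k ^ (-2)` says
exactly that `k √q ≥ 1` (`sum_choose_sq_le`, `le_sum_choose_sq`). Expanding `log (1 + √q * exp s)`
to first order in `s` produces `exp (-k² / (2 μ_q N))`, since `(1 - √q) / (1 + √q) = 1 / μ_q`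
(`tilt_bounds`). -/

noncomputable section

namespace Meixner

/-! ### Algebraic relations of the Meixner polynomials -/

/-- The Meixner polynomial of degree `n` for the weights `(y + k).choose k * (1 + d)⁻¹ ^ y`,
evaluated at `y`. -/
def meixner (d : ℝ) (k n y : ℕ) : ℝ :=
  ∑ j ∈ Finset.range (n + 1), ((n + k).choose (k + j) : ℝ) * (y.choose j * (-d) ^ j)

theorem meixner_eq_sum (d : ℝ) (k n y : ℕ) {R : ℕ} (hR : n + 1 ≤ R) :
    meixner d k n y =
      ∑ j ∈ Finset.range R, ((n + k).choose (k + j) : ℝ) * (y.choose j * (-d) ^ j) := by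
  refine Finset.sum_subset (Finset.range_mono hR) fun j _ hj => ?_
  rw [Finset.mem_range, not_lt] at hj
  rw [Nat.choose_eq_zero_of_lt (by omega)]
  simp

@[simp] theorem meixner_zero_deg (d : ℝ) (k y : ℕ) : meixner d k 0 y = 1 := by
  simp [meixner]

/-- Pascal's rule in `y`. The forward difference lowers the degree and raises the weight parameter;
this drives the orthogonality proof. -/
theorem meixner_diff (d : ℝ) (k n y : ℕ) :
    meixner d k (n + 1) (y + 1) - meixner d k (n + 1) y = -d * meixner d (k + 1) n y := by
  rw [meixner, meixner, ← Finset.sum_sub_distrib, Finset.sum_range_succ', meixner, Finset.mul_sum]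
  simp only [Nat.choose_zero_right, sub_self, add_zero]
  refine Finset.sum_congr rfl fun j _ => ?_
  rw [Nat.choose_succ_succ y j, show n + 1 + k = n + (k + 1) by ring,
    show k + (j + 1) = k + 1 + j by ring]
  push_cast
  ring

/-- Pascal's rule in the coefficient `(n + k).choose (k + j)` compares the parameters `k` and `k +
1` at the same point; adding the forward difference gives one step of the connection formula. -/
theorem meixner_shift (d : ℝ) (k n y : ℕ) :
    meixner d k (n + 1) (y + 1) =
      meixner d (k + 1) (n + 1) y - (1 + d) * meixner d (k + 1) n y := by
  have h : meixner d k (n + 1) y = meixner d (k + 1) (n + 1) y - meixner d (k + 1) n y := by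
    rw [meixner_eq_sum d (k + 1) n y (Nat.le_succ (n + 1)), meixner, meixner,
      ← Finset.sum_sub_distrib]
    refine Finset.sum_congr rfl fun j _ => ?_
    have := Nat.choose_succ_succ (n + 1 + k) (k + j)
    rw [show n + 1 + (k + 1) = (n + 1 + k).succ by omega, show k + 1 + j = (k + j).succ by omega,
      this, show n + (k + 1) = n + 1 + k by ring]
    push_cast
    ring
  linear_combination meixner_diff d k n y + h

theorem mul_choose_pred (y j : ℕ) :
    (y : ℝ) * ((y - 1).choose j : ℝ) = (j + 1) * y.choose (j + 1) := by
  cases y with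
  | zero => simp
  | succ y =>
    have := Nat.add_one_mul_choose_eq y j
    rw [Nat.add_sub_cancel, mul_comm ((j : ℝ) + 1)]
    exact_mod_cast this

theorem mul_choose_self (y j : ℕ) :
    (y : ℝ) * (y.choose j : ℝ) = (j + 1) * y.choose (j + 1) + j * y.choose j := by
  rcases le_or_gt j y with h | h
  · have := Nat.choose_succ_right_eq y j
    have h2 : (y.choose (j + 1) : ℝ) * (j + 1) = y.choose j * (y - j) := by
      rw [← Nat.cast_sub h]; exact_mod_cast this
    linear_combination -h2
  · rw [Nat.choose_eq_zero_of_lt h, Nat.choose_eq_zero_of_lt (by omega)]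
    simp

/-- The raising relation: the left side is, up to sign, the adjoint of the forward difference for
the negative binomial weights. The truncated `y - 1` is harmless because of the factor `y`. -/
theorem meixner_raise (d : ℝ) (k n y : ℕ) :
    (y + k + 1) * meixner d (k + 1) n y - (1 + d) * (y * meixner d (k + 1) n (y - 1)) =
      (n + 1) * meixner d k (n + 1) y := by
  have e1 : (y + k + 1) * meixner d (k + 1) n y - (1 + d) * (y * meixner d (k + 1) n (y - 1)) =
      ∑ j ∈ Finset.range (n + 1), ((n + 1 + k).choose (k + (j + 1)) : ℝ) *
          (((j + 1 : ℕ) : ℝ) * y.choose (j + 1) * (-d) ^ (j + 1)) +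
        ∑ j ∈ Finset.range (n + 1), ((n + 1 + k).choose (k + 1 + j) : ℝ) *
          ((j + k + 1) * (y.choose j * (-d) ^ j)) := by
    simp only [meixner, Finset.mul_sum]
    rw [← Finset.sum_sub_distrib, ← Finset.sum_add_distrib]
    refine Finset.sum_congr rfl fun j _ => ?_
    rw [show n + (k + 1) = n + 1 + k by ring, show k + (j + 1) = k + 1 + j by ring]
    push_cast
    linear_combination ((n + 1 + k).choose (k + 1 + j) : ℝ) * (-d) ^ j * mul_choose_self y j -
      (1 + d) * ((n + 1 + k).choose (k + 1 + j) : ℝ) * (-d) ^ j * mul_choose_pred y j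
  have e2 := Finset.sum_range_succ' (fun j => ((n + 1 + k).choose (k + j) : ℝ) *
          ((j : ℝ) * y.choose j * (-d) ^ j)) (n + 1)
  have e3 : ∑ j ∈ Finset.range (n + 1), ((n + 1 + k).choose (k + 1 + j) : ℝ) *
          ((j + k + 1) * (y.choose j * (-d) ^ j)) = ∑ j ∈ Finset.range (n + 1 + 1),
          ((n + 1 + k).choose (k + 1 + j) : ℝ) * ((j + k + 1) * (y.choose j * (-d) ^ j)) := by
    rw [Finset.sum_range_succ _ (n + 1), Nat.choose_eq_zero_of_lt (by omega)]
    simp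
  simp only [Nat.cast_zero, zero_mul, mul_zero, add_zero] at e2
  rw [e1, ← e2, e3, ← Finset.sum_add_distrib, meixner, Finset.mul_sum]
  refine Finset.sum_congr rfl fun j hj => ?_
  have hj' : k + j ≤ n + 1 + k := by have := Finset.mem_range.1 hj; omega
  have h := Nat.choose_succ_right_eq (n + 1 + k) (k + j)
  have h2 : ((n + 1 + k).choose (k + 1 + j) : ℝ) * (k + j + 1) =
      (n + 1 + k).choose (k + j) * (n + 1 - j) := by
    have : (((n + 1 + k - (k + j) : ℕ)) : ℝ) = n + 1 - j := by
      rw [Nat.cast_sub hj']; push_cast; ring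
    rw [← this, show k + 1 + j = k + j + 1 by ring]; exact_mod_cast h
  linear_combination (y.choose j * (-d) ^ j) * h2

theorem meixner_recurrence (d : ℝ) (n x : ℕ) :
    (n + 2) * meixner d 0 (n + 2) x =
      (2 * n + 3 + (n + 1) * d - d * x) * meixner d 0 (n + 1) x -
        (n + 1) * (1 + d) * meixner d 0 n x := by
  have hA : (n + 2) * meixner d 0 (n + 2) x - (2 * n + 3) * meixner d 0 (n + 1) x +
      (n + 1) * meixner d 0 n x = ∑ j ∈ Finset.range (n + 2), ((n + 1).choose j : ℝ) *
        ((j + 1) * x.choose (j + 1) * (-d) ^ (j + 1)) := by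
    rw [meixner_eq_sum d 0 n x (R := n + 3) (by omega),
      meixner_eq_sum d 0 (n + 1) x (R := n + 3) (by omega), meixner]
    simp only [Finset.mul_sum]
    rw [← Finset.sum_sub_distrib, ← Finset.sum_add_distrib, Finset.sum_range_succ']
    simp only [zero_add, add_zero, Nat.choose_zero_right]
    -- The constant terms cancel: `(n + 2) - (2 n + 3) + (n + 1) = 0`.
    have h0 : ∀ s : ℝ, s + (((n : ℝ) + 2) * ((1 : ℕ) * ((1 : ℕ) * (-d) ^ 0)) -
        (2 * n + 3) * ((1 : ℕ) * ((1 : ℕ) * (-d) ^ 0)) +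
        (n + 1) * ((1 : ℕ) * ((1 : ℕ) * (-d) ^ 0))) = s := by intro s; push_cast; ring
    rw [h0]
    refine Finset.sum_congr rfl fun j hj => ?_
    have hj' : j ≤ n + 1 := by have := Finset.mem_range.1 hj; omega
    have h := Nat.choose_mul_succ_eq n j
    have h2 : (n.choose j : ℝ) * (n + 1) = (n + 1).choose j * (n + 1 - j) := by
      have : (((n + 1 - j : ℕ)) : ℝ) = n + 1 - j := by rw [Nat.cast_sub hj']; push_cast; ring
      rw [← this]; exact_mod_cast h
    have e1 : ((n + 2).choose (j + 1) : ℝ) = (n + 1).choose j + (n + 1).choose (j + 1) := by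
      exact_mod_cast Nat.choose_succ_succ (n + 1) j
    have e2 : ((n + 1).choose (j + 1) : ℝ) = n.choose j + n.choose (j + 1) := by
      exact_mod_cast Nat.choose_succ_succ n j
    rw [e1, e2]
    linear_combination -(x.choose (j + 1) * (-d) ^ (j + 1)) * h2
  have hB : (n + 1) * meixner d 0 (n + 1) x - (n + 1) * meixner d 0 n x =
      ∑ j ∈ Finset.range (n + 2), ((n + 1).choose j : ℝ) * (j * x.choose j * (-d) ^ j) := by
    rw [meixner_eq_sum d 0 n x (R := n + 2) (by omega), meixner]
    simp only [Finset.mul_sum]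
    rw [← Finset.sum_sub_distrib]
    refine Finset.sum_congr rfl fun j hj => ?_
    have hj' : j ≤ n + 1 := by have := Finset.mem_range.1 hj; omega
    have h := Nat.choose_mul_succ_eq n j
    have h2 : (n.choose j : ℝ) * (n + 1) = (n + 1).choose j * (n + 1 - j) := by
      have : (((n + 1 - j : ℕ)) : ℝ) = n + 1 - j := by rw [Nat.cast_sub hj']; push_cast; ring
      rw [← this]; exact_mod_cast h
    simp only [zero_add, add_zero]
    linear_combination -(x.choose j * (-d) ^ j) * h2
  -- All three identities are expansions in the basis `x.choose j`; the recurrence is the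
  -- combination of them in which the sums cancel.
  have hC : -d * x * meixner d 0 (n + 1) x = ∑ j ∈ Finset.range (n + 2), ((n + 1).choose j : ℝ) *
        ((j + 1) * x.choose (j + 1) * (-d) ^ (j + 1)) + -d *
      ∑ j ∈ Finset.range (n + 2), ((n + 1).choose j : ℝ) * (j * x.choose j * (-d) ^ j) := by
    rw [meixner]
    simp only [Finset.mul_sum]
    rw [← Finset.sum_add_distrib]
    refine Finset.sum_congr rfl fun j _ => ?_
    simp only [zero_add, add_zero]
    linear_combination (-d) * ((n + 1).choose j : ℝ) * (-d) ^ j * mul_choose_self x j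
  linear_combination hA - d * hB - hC

/-- The value `meixner d 0 n (y + k)` in terms of the polynomials for the shifted weights. -/
theorem meixner_shift_iterate (d : ℝ) (a k n y : ℕ) :
    meixner d a n (y + k) = ∑ p ∈ Finset.HasAntidiagonal.antidiagonal n,
      ((k.choose p.1 : ℝ) * (-(1 + d)) ^ p.1) * meixner d (a + k) p.2 y := by
  induction k generalizing a n with
  | zero =>
    rw [Finset.Nat.sum_antidiagonal_eq_sum_range_succ_mk, Finset.sum_range_succ']
    simp
  | succ k ih =>
    cases n with
    | zero => simp
    | succ n =>
      rw [← add_assoc, meixner_shift, ih, ih, Finset.Nat.sum_antidiagonal_succ,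
        Finset.Nat.sum_antidiagonal_succ, Finset.mul_sum, add_sub_assoc,
        ← Finset.sum_sub_distrib]
      have e : a + 1 + k = a + (k + 1) := by ring
      congr 1
      · simp [e]
      · refine Finset.sum_congr rfl fun p _ => ?_
        rw [e]
        dsimp only
        rw [Nat.choose_succ_succ k p.1]
        push_cast
        ring

/-! ### Summation by parts and orthogonality -/

/-- The polynomial with values `y.choose j` at the natural numbers `y`. -/
def binomPoly (j : ℕ) : ℝ[X] := C ((j.factorial : ℝ)⁻¹) * descPochhammer ℝ j

@[simp] theorem binomPoly_eval (j y : ℕ) : (binomPoly j).eval (y : ℝ) = y.choose j := by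
  rw [binomPoly, eval_mul, eval_C, descPochhammer_eval_eq_descFactorial,
    Nat.descFactorial_eq_factorial_mul_choose]
  have : (j.factorial : ℝ) ≠ 0 := by positivity
  push_cast
  field_simp

/-- The polynomial with values `meixner d k n y` at the natural numbers `y`. -/
def meixnerPoly (d : ℝ) (k n : ℕ) : ℝ[X] :=
  ∑ j ∈ Finset.range (n + 1), C (((n + k).choose (k + j) : ℝ) * (-d) ^ j) * binomPoly j

@[simp] theorem meixnerPoly_eval (d : ℝ) (k n y : ℕ) :
    (meixnerPoly d k n).eval (y : ℝ) = meixner d k n y := by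
  rw [meixnerPoly, eval_finsetSum, meixner]
  refine Finset.sum_congr rfl fun j _ => ?_
  rw [eval_mul, eval_C, binomPoly_eval]
  ring

theorem summable_eval_mul_pow (p : ℝ[X]) {c : ℝ} (h0 : 0 ≤ c) (h1 : c < 1) :
    Summable fun y : ℕ => p.eval (y : ℝ) * c ^ y := by
  have : (fun y : ℕ => p.eval (y : ℝ) * c ^ y) = fun y : ℕ =>
      ∑ i ∈ Finset.range (p.natDegree + 1), p.coeff i * ((y : ℝ) ^ i * c ^ y) := by
    funext y
    rw [eval_eq_sum_range, Finset.sum_mul]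
    exact Finset.sum_congr rfl fun i _ => by ring
  rw [this]
  refine summable_sum fun i _ => Summable.mul_left _ ?_
  exact summable_pow_mul_geometric_of_norm_lt_one i
    (by rwa [Real.norm_of_nonneg h0])

theorem summable_choose_mul_eval (p : ℝ[X]) (k : ℕ) {c : ℝ} (h0 : 0 ≤ c) (h1 : c < 1) :
    Summable fun y : ℕ => ((y + k).choose k : ℝ) * c ^ y * p.eval (y : ℝ) := by
  refine (summable_eval_mul_pow ((binomPoly k).comp (X + C (k : ℝ)) * p) h0 h1).congr fun y => ?_
  have : (binomPoly k).eval ((y : ℝ) + k) = (y + k).choose k := by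
    exact_mod_cast binomPoly_eval k (y + k)
  simp only [eval_mul, eval_comp, eval_add, eval_X, eval_C, this]
  ring

/-- Summation by parts for the forward difference between the weights with parameters `k` and
`k + 1`. -/
theorem tsum_diff_mul (f g : ℝ[X]) (k : ℕ) {c : ℝ} (h0 : 0 < c) (h1 : c < 1) :
    (k + 1) * ∑' y : ℕ, ((y + (k + 1)).choose (k + 1) : ℝ) * c ^ y *
        ((f.eval ((y + 1 : ℕ) : ℝ) - f.eval (y : ℝ)) * g.eval (y : ℝ)) =
      ∑' y : ℕ, ((y + k).choose k : ℝ) * c ^ y * (f.eval (y : ℝ) *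
        (c⁻¹ * (y * g.eval ((y - 1 : ℕ) : ℝ)) - (y + k + 1) * g.eval (y : ℝ))) := by
  have s1 : Summable fun y : ℕ => ((y + (k + 1)).choose (k + 1) : ℝ) * c ^ y *
      (f.eval ((y + 1 : ℕ) : ℝ) * g.eval (y : ℝ)) := by
    refine (summable_choose_mul_eval (f.comp (X + 1) * g) (k + 1) h0.le h1).congr fun y => ?_
    simp
  have s2 : Summable fun y : ℕ => ((y + (k + 1)).choose (k + 1) : ℝ) * c ^ y *
      (f.eval (y : ℝ) * g.eval (y : ℝ)) := by
    refine (summable_choose_mul_eval (f * g) (k + 1) h0.le h1).congr fun y => ?_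
    simp
  -- After the shift `y ↦ y + 1` this is the part of the left-hand summand containing `f (y + 1)`.
  -- Nothing is lost at the boundary because `u 0 = 0`.
  set u : ℕ → ℝ := fun y => ((y + k).choose k : ℝ) * c ^ y *
    (f.eval (y : ℝ) * (c⁻¹ * (y * g.eval ((y - 1 : ℕ) : ℝ)))) with hu
  have hu1 : ∀ y, u (y + 1) = (k + 1) * (((y + (k + 1)).choose (k + 1) : ℝ) * c ^ y *
      (f.eval ((y + 1 : ℕ) : ℝ) * g.eval (y : ℝ))) := by
    intro y
    have h : (((y + (k + 1)).choose (k + 1) : ℕ) : ℝ) * (k + 1) =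
        (y + 1 + k).choose k * (y + 1) := by
      have := Nat.choose_succ_right_eq (y + 1 + k) k
      rw [show y + 1 + k - k = y + 1 by omega] at this
      rw [show y + (k + 1) = y + 1 + k by ring]
      exact_mod_cast this
    have hc : c ^ (y + 1) * c⁻¹ = c ^ y := by rw [pow_succ]; field_simp
    simp only [hu, Nat.add_sub_cancel]
    rw [← mul_assoc, mul_comm ((k : ℝ) + 1), ← hc]
    push_cast
    linear_combination -(c ^ (y + 1) * c⁻¹ * (f.eval ((y : ℝ) + 1) * g.eval (y : ℝ))) * h
  have su : Summable u := by
    rw [← summable_nat_add_iff 1]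
    exact (s1.mul_left _).congr fun y => (hu1 y).symm
  have hv : ∀ y : ℕ, ((y + k).choose k : ℝ) * c ^ y * (f.eval (y : ℝ) *
      (c⁻¹ * (y * g.eval ((y - 1 : ℕ) : ℝ)) - (y + k + 1) * g.eval (y : ℝ))) =
      u y - (k + 1) * (((y + (k + 1)).choose (k + 1) : ℝ) * c ^ y *
      (f.eval (y : ℝ) * g.eval (y : ℝ))) := by
    intro y
    have h : (y + k + 1) * ((y + k).choose k : ℝ) =
        ((y + (k + 1)).choose (k + 1) : ℕ) * (k + 1) := by
      exact_mod_cast Nat.add_one_mul_choose_eq (y + k) k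
    simp only [hu]
    linear_combination -(c ^ y * (f.eval (y : ℝ) * g.eval (y : ℝ))) * h
  rw [tsum_congr hv, su.tsum_sub (s2.mul_left _), su.tsum_eq_zero_add, tsum_congr hu1,
    tsum_mul_left, tsum_mul_left]
  have hu0 : u 0 = 0 := by simp [hu]
  rw [hu0, zero_add, ← mul_sub, ← s1.tsum_sub s2]
  congr 1
  exact tsum_congr fun y => by ring

theorem summable_meixner_mul (d : ℝ) (k n m : ℕ) {c : ℝ} (h0 : 0 ≤ c) (h1 : c < 1) :
    Summable fun y : ℕ => ((y + k).choose k : ℝ) * c ^ y *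
      (meixner d k n y * meixner d k m y) :=
  (summable_choose_mul_eval (meixnerPoly d k n * meixnerPoly d k m) k h0 h1).congr fun y => by
    simp

/-- Summation by parts lets the difference act on one factor and the raising relation on the other,
so the pair `(n + 1, m + 1)` at parameter `k` reduces to `(n, m)` at `k + 1`. If one degree reaches
zero first, the difference of a constant vanishes; if both do, the negative binomial series remains.
-/
theorem tsum_meixner_mul (k n m : ℕ) {c d : ℝ} (h0 : 0 < c) (h1 : c < 1) (hd : 1 + d = c⁻¹) :
    ∑' y : ℕ, ((y + k).choose k : ℝ) * c ^ y * (meixner d k n y * meixner d k m y) =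
      if n = m then ((n + k).choose k : ℝ) * (c⁻¹ ^ n * (1 - c)⁻¹ ^ (k + 1)) else 0 := by
  have raise : ∀ (k m y : ℕ), c⁻¹ * (y * (meixnerPoly d (k + 1) m).eval ((y - 1 : ℕ) : ℝ)) -
      (y + k + 1) * (meixnerPoly d (k + 1) m).eval (y : ℝ) =
      -((m + 1) * meixner d k (m + 1) y) := by
    intro k m y
    rw [meixnerPoly_eval, meixnerPoly_eval, ← hd]
    linear_combination -meixner_raise d k m y
  have hzero : ∀ k m : ℕ, ∑' y : ℕ, ((y + k).choose k : ℝ) * c ^ y *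
      (meixner d k 0 y * meixner d k (m + 1) y) = 0 := by
    intro k m
    have h := tsum_diff_mul 1 (meixnerPoly d (k + 1) m) k h0 h1
    simp only [raise] at h
    simp only [eval_one, sub_self, zero_mul, mul_zero, tsum_zero, one_mul] at h
    have e : ∀ y : ℕ, ((y + k).choose k : ℝ) * c ^ y * -((m + 1) * meixner d k (m + 1) y) =
        -((m : ℝ) + 1) * (((y + k).choose k : ℝ) * c ^ y *
          (meixner d k 0 y * meixner d k (m + 1) y)) := by
      intro y; rw [meixner_zero_deg]; ring
    rw [tsum_congr e, tsum_mul_left] at h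
    have hm : -((m : ℝ) + 1) ≠ 0 := by
      have : (0 : ℝ) < m + 1 := by positivity
      linarith
    exact (mul_eq_zero.1 h.symm).resolve_left hm
  induction n generalizing k m with
  | zero =>
    cases m with
    | zero =>
      simp only [meixner_zero_deg, mul_one, if_true]
      rw [tsum_choose_mul_geometric_of_norm_lt_one k (by rwa [Real.norm_of_nonneg h0.le])]
      simp
    | succ m => simpa using hzero k m
  | succ n ih =>
    cases m with
    | zero =>
      rw [if_neg (Nat.succ_ne_zero n), ← hzero k n]
      exact tsum_congr fun y => by ring
    | succ m =>
      have h := tsum_diff_mul (meixnerPoly d k (n + 1)) (meixnerPoly d (k + 1) m) k h0 h1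
      simp only [raise] at h
      simp only [meixnerPoly_eval, meixner_diff] at h
      have e : ∀ y : ℕ, ((y + k).choose k : ℝ) * c ^ y *
          (meixner d k (n + 1) y * -((m + 1) * meixner d k (m + 1) y)) =
          -((m : ℝ) + 1) * (((y + k).choose k : ℝ) * c ^ y *
          (meixner d k (n + 1) y * meixner d k (m + 1) y)) := fun y => by ring
      have e' : ∀ y : ℕ, ((y + (k + 1)).choose (k + 1) : ℝ) * c ^ y *
          (-d * meixner d (k + 1) n y * meixner d (k + 1) m y) =
          -d * (((y + (k + 1)).choose (k + 1) : ℝ) * c ^ y *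
          (meixner d (k + 1) n y * meixner d (k + 1) m y)) := fun y => by ring
      rw [tsum_congr e, tsum_congr e', tsum_mul_left, tsum_mul_left, ih] at h
      have hm : (m : ℝ) + 1 ≠ 0 := by positivity
      rw [← mul_right_inj' (neg_ne_zero.2 hm), ← h]
      by_cases hnm : n = m
      · subst hnm
        have hch : (((n + (k + 1)).choose (k + 1) : ℕ) : ℝ) * (k + 1) =
            (n + 1 + k).choose k * (n + 1) := by
          have := Nat.choose_succ_right_eq (n + 1 + k) k
          rw [show n + 1 + k - k = n + 1 by omega] at this
          rw [show n + (k + 1) = n + 1 + k by ring]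
          exact_mod_cast this
        have hc1 : 1 - c ≠ 0 := by linarith
        have hdc : d * (1 - c)⁻¹ = c⁻¹ := by
          rw [eq_sub_of_add_eq' hd]; field_simp
        simp only [if_true]
        rw [pow_succ c⁻¹ n, pow_succ (1 - c)⁻¹ (k + 1)]
        linear_combination -(d * (c⁻¹ ^ n * ((1 - c)⁻¹ ^ (k + 1) * (1 - c)⁻¹))) * hch -
          (n + 1) * ((n + 1 + k).choose k : ℝ) * c⁻¹ ^ n * (1 - c)⁻¹ ^ (k + 1) * hdc
      · simp [hnm]

/-! ### The orthonormal polynomials of Geo(q) -/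

theorem symm_ne_zero {q : unitInterval} (h1 : (q : ℝ) < 1) : unitInterval.symm q ≠ 0 := by
  intro h
  have := congrArg Subtype.val h
  simp only [unitInterval.coe_symm_eq, Set.Icc.coe_zero] at this
  linarith

theorem integrable_eval_geo {q : unitInterval} (h1 : (q : ℝ) < 1) (f : ℝ[X]) :
    Integrable (fun y : ℕ => f.eval (y : ℝ)) (geo q) := by
  rw [geo, integrable_geometricMeasure_iff (symm_ne_zero h1)]
  refine ((summable_eval_mul_pow f q.2.1 h1).norm.mul_left (1 - (q : ℝ))).congr fun y => ?_
  have : |(q : ℝ) ^ y| = (q : ℝ) ^ y := abs_of_nonneg (pow_nonneg q.2.1 _)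
  simp only [Real.norm_eq_abs, abs_mul, this, unitInterval.coe_symm_eq, sub_sub_cancel]
  ring

theorem integral_eval_geo {q : unitInterval} (h1 : (q : ℝ) < 1) (f : ℝ[X]) :
    ∫ y : ℕ, f.eval (y : ℝ) ∂(geo q) = (1 - q) * ∑' y : ℕ, f.eval (y : ℝ) * (q : ℝ) ^ y := by
  have := hasSum_integral_geometricMeasure (symm_ne_zero h1) (integrable_eval_geo h1 f)
  rw [geo, ← this.tsum_eq, ← tsum_mul_left]
  refine tsum_congr fun y => ?_
  simp only [unitInterval.coe_symm_eq, sub_sub_cancel, smul_eq_mul]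
  ring

/-- Integration of polynomials against `geo q` as a linear map. -/
def geoIntegral {q : unitInterval} (h1 : (q : ℝ) < 1) : ℝ[X] →ₗ[ℝ] ℝ where
  toFun f := ∫ y : ℕ, f.eval (y : ℝ) ∂(geo q)
  map_add' f g := by
    simp only [eval_add]
    exact integral_add (integrable_eval_geo h1 f) (integrable_eval_geo h1 g)
  map_smul' a f := by
    simp only [eval_smul, smul_eq_mul, RingHom.id_apply, integral_const_mul]

theorem polyInner_eq_geoIntegral {q : unitInterval} (h1 : (q : ℝ) < 1) (f g : ℝ[X]) :
    polyInner q f g = geoIntegral h1 (f * g) := by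
  simp [polyInner, geoIntegral]

theorem polyInner_sub_left {q : unitInterval} (h1 : (q : ℝ) < 1) (f g h : ℝ[X]) :
    polyInner q (f - g) h = polyInner q f h - polyInner q g h := by
  simp only [polyInner_eq_geoIntegral h1, sub_mul, map_sub]

theorem polyInner_C_mul_left {q : unitInterval} (h1 : (q : ℝ) < 1) (a : ℝ) (f h : ℝ[X]) :
    polyInner q (C a * f) h = a * polyInner q f h := by
  simp only [polyInner_eq_geoIntegral h1, ← smul_eq_C_mul, smul_mul_assoc, map_smul, smul_eq_mul]

theorem polyInner_C_mul_right {q : unitInterval} (h1 : (q : ℝ) < 1) (a : ℝ) (f h : ℝ[X]) :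
    polyInner q h (C a * f) = a * polyInner q h f := by
  rw [polyInner_eq_geoIntegral h1, mul_comm, ← polyInner_eq_geoIntegral h1,
    polyInner_C_mul_left h1, polyInner_eq_geoIntegral h1, mul_comm f,
    ← polyInner_eq_geoIntegral h1]

theorem polyInner_sum_left {q : unitInterval} (h1 : (q : ℝ) < 1) {ι : Type*} (s : Finset ι)
    (f : ι → ℝ[X]) (h : ℝ[X]) :
    polyInner q (∑ i ∈ s, f i) h = ∑ i ∈ s, polyInner q (f i) h := by
  simp only [polyInner_eq_geoIntegral h1, Finset.sum_mul, map_sum]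

theorem polyInner_meixnerPoly {q : unitInterval} (h0 : 0 < (q : ℝ)) (h1 : (q : ℝ) < 1) {d : ℝ}
    (hd : 1 + d = (q : ℝ)⁻¹) (n m : ℕ) :
    polyInner q (meixnerPoly d 0 n) (meixnerPoly d 0 m) = if n = m then (q : ℝ)⁻¹ ^ n else 0 := by
  have h := tsum_meixner_mul 0 n m h0 h1 hd
  have e : ∀ y : ℕ, ((y + 0).choose 0 : ℝ) * (q : ℝ) ^ y * (meixner d 0 n y * meixner d 0 m y) =
      (meixnerPoly d 0 n * meixnerPoly d 0 m).eval (y : ℝ) * (q : ℝ) ^ y := by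
    intro y
    simp only [eval_mul, meixnerPoly_eval, Nat.choose_zero_right, Nat.cast_one]
    ring
  rw [tsum_congr e] at h
  rw [polyInner_eq_geoIntegral h1]
  change ∫ y : ℕ, _ ∂(geo q) = _
  rw [integral_eval_geo h1, h]
  have : 1 - (q : ℝ) ≠ 0 := by linarith
  split_ifs
  · simp only [Nat.choose_zero_right, Nat.cast_one]
    rw [pow_one, one_mul, mul_comm, mul_assoc, inv_mul_cancel₀ this, mul_one]
  · simp

theorem degree_C_mul_le_degree (a : ℝ) (f : ℝ[X]) : (C a * f).degree ≤ f.degree := by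
  rw [← smul_eq_C_mul]
  exact degree_smul_le a f

theorem binomPoly_natDegree (j : ℕ) : (binomPoly j).natDegree = j := by
  rw [binomPoly, natDegree_C_mul (by positivity), descPochhammer_natDegree]

theorem meixnerPoly_degree_lt (d : ℝ) (n : ℕ) :
    (∑ j ∈ Finset.range n, C ((n.choose j : ℝ) * (-d) ^ j) * binomPoly j).degree < (n : WithBot ℕ) := by
  rcases Nat.eq_zero_or_pos n with rfl | hn
  · simp
  refine (degree_sum_le _ _).trans_lt ?_
  rw [Finset.sup_lt_iff (WithBot.bot_lt_coe _)]
  intro j hj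
  refine (degree_C_mul_le_degree _ _).trans_lt ?_
  refine degree_le_natDegree.trans_lt ?_
  rw [binomPoly_natDegree]
  exact_mod_cast Finset.mem_range.1 hj

/-- The monic multiple of `meixnerPoly d 0 n` differs from `X ^ n` by lower order terms. -/
theorem degree_X_pow_sub_meixnerPoly {d : ℝ} (hd : d ≠ 0) (n : ℕ) :
    (X ^ n - C (n.factorial / (-d) ^ n) * meixnerPoly d 0 n).degree < (n : WithBot ℕ) := by
  have hn : (n.factorial : ℝ) ≠ 0 := by positivity
  have hdn : (-d) ^ n ≠ 0 := pow_ne_zero _ (neg_ne_zero.2 hd)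
  have e : C (n.factorial / (-d) ^ n) * meixnerPoly d 0 n =
      C (n.factorial / (-d) ^ n) *
        (∑ j ∈ Finset.range n, C ((n.choose j : ℝ) * (-d) ^ j) * binomPoly j) +
      descPochhammer ℝ n := by
    rw [meixnerPoly, Finset.sum_range_succ, mul_add]
    simp only [zero_add, add_zero, Nat.choose_self, Nat.cast_one, one_mul]
    congr 1
    rw [binomPoly, ← mul_assoc, ← mul_assoc, ← C_mul, ← C_mul]
    have : n.factorial / (-d) ^ n * (-d) ^ n * (n.factorial : ℝ)⁻¹ = 1 := by field_simp
    rw [this, C_1, one_mul]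
  rw [e, sub_add_eq_sub_sub_swap]
  refine (degree_sub_le _ _).trans_lt (max_lt ?_ ?_)
  · have h := degree_sub_lt_left (p := (X : ℝ[X]) ^ n) (q := descPochhammer ℝ n) ?_ (by simp) ?_
    · rwa [degree_X_pow] at h
    · rw [degree_X_pow, degree_eq_natDegree (monic_descPochhammer ℝ n).ne_zero,
        descPochhammer_natDegree]
    · rw [leadingCoeff_X_pow, (monic_descPochhammer ℝ n).leadingCoeff]
  · exact (degree_C_mul_le_degree _ _).trans_lt (meixnerPoly_degree_lt d n)

/-- Triangularity: subtracting the right multiple of the top Meixner polynomial lowers the degree.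
-/
theorem exists_eq_sum_meixnerPoly {d : ℝ} (hd : d ≠ 0) (n : ℕ) (f : ℝ[X]) (hf : f.degree < (n : WithBot ℕ)) :
    ∃ b : ℕ → ℝ, f = ∑ m ∈ Finset.range n, C (b m) * meixnerPoly d 0 m := by
  induction n generalizing f with
  | zero =>
    refine ⟨0, ?_⟩
    rw [Finset.sum_range_zero]
    by_contra h
    rw [degree_eq_natDegree h] at hf
    exact absurd hf (by simp)
  | succ n ih =>
    set a := (n.factorial : ℝ) / (-d) ^ n
    have hdeg : (f - C (f.coeff n * a) * meixnerPoly d 0 n).degree < (n : WithBot ℕ) := by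
      have e : f - C (f.coeff n * a) * meixnerPoly d 0 n = (f - C (f.coeff n) * X ^ n) +
          C (f.coeff n) * (X ^ n - C a * meixnerPoly d 0 n) := by
        rw [C_mul]; ring
      rw [e]
      refine (degree_add_le _ _).trans_lt (max_lt ?_ ?_)
      · rw [degree_lt_iff_coeff_zero]
        intro m hm
        rw [coeff_sub, coeff_C_mul, coeff_X_pow]
        rcases eq_or_ne m n with rfl | hmn
        · simp
        · have : f.coeff m = 0 := coeff_eq_zero_of_degree_lt
            (hf.trans_le (by exact_mod_cast Nat.succ_le_of_lt (lt_of_le_of_ne hm hmn.symm)))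
          simp [this, hmn]
      · exact (degree_C_mul_le_degree _ _).trans_lt (degree_X_pow_sub_meixnerPoly hd n)
    obtain ⟨b, hb⟩ := ih _ hdeg
    refine ⟨Function.update b n (f.coeff n * a), ?_⟩
    rw [Finset.sum_range_succ, Function.update_self]
    rw [Finset.sum_congr rfl fun m hm => by
      rw [Function.update_of_ne (Finset.mem_range.1 hm).ne], ← hb]
    ring

/-- The difference between `X ^ n` and the monic Meixner polynomial is a combination of lower ones
with coefficients `b m`. Pairing with the `m`-th one identifies these with the Gram–Schmidt
projection coefficients. -/
theorem monicPoly_eq {q : unitInterval} (h0 : 0 < (q : ℝ)) (h1 : (q : ℝ) < 1) {d : ℝ}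
    (hd : 1 + d = (q : ℝ)⁻¹) (hd0 : d ≠ 0) (n : ℕ) :
    monicPoly q n = C (n.factorial / (-d) ^ n) * meixnerPoly d 0 n := by
  induction n using Nat.strong_induction_on with
  | _ n ih =>
    obtain ⟨b, hb⟩ := exists_eq_sum_meixnerPoly hd0 n _ (degree_X_pow_sub_meixnerPoly hd0 n)
    have hqm : ∀ m : ℕ, (q : ℝ)⁻¹ ^ m ≠ 0 := fun m => by positivity
    have hbm : ∀ m < n, polyInner q (X ^ n) (meixnerPoly d 0 m) = b m * (q : ℝ)⁻¹ ^ m := by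
      intro m hm
      have h := congrArg (fun f => polyInner q f (meixnerPoly d 0 m)) hb
      simp only [polyInner_sub_left h1, polyInner_sum_left h1, polyInner_C_mul_left h1,
        polyInner_meixnerPoly h0 h1 hd, mul_ite, mul_zero, Finset.sum_ite_eq', Finset.mem_range,
        hm, if_true, hm.ne', if_false, sub_zero] at h
      exact h
    rw [monicPoly, Finset.sum_congr rfl (g := fun m : Fin n => C (b m) * meixnerPoly d 0 m),
      Fin.sum_univ_eq_sum_range (fun m => C (b m) * meixnerPoly d 0 m) n, ← hb]
    · ring
    · intro m _
      have hm := m.2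
      have ha : (Nat.factorial m : ℝ) / (-d) ^ (m : ℕ) ≠ 0 :=
        div_ne_zero (by positivity) (pow_ne_zero _ (neg_ne_zero.2 hd0))
      rw [ih m hm, polyInner_C_mul_right h1, polyInner_C_mul_right h1, polyInner_C_mul_left h1,
        hbm m hm, polyInner_meixnerPoly h0 h1 hd, if_pos rfl, ← mul_assoc, ← C_mul]
      congr 2
      have hdm : (-d) ^ (m : ℕ) ≠ 0 := pow_ne_zero _ (neg_ne_zero.2 hd0)
      field_simp [hqm m]

/-- The squared norm of `meixnerPoly d 0 n` is `q⁻¹ ^ n`, and its leading coefficient has sign `(-1)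
^ n`, which the normalisation undoes. -/
theorem orthoPoly_eq {q : unitInterval} (h0 : 0 < (q : ℝ)) (h1 : (q : ℝ) < 1) {d : ℝ}
    (hd : 1 + d = (q : ℝ)⁻¹) (hd0 : 0 < d) (n : ℕ) :
    orthoPoly q n = C ((-1) ^ n * √(q : ℝ) ^ n) * meixnerPoly d 0 n := by
  rw [orthoPoly, monicPoly_eq h0 h1 hd hd0.ne', polyInner_C_mul_right h1, polyInner_C_mul_left h1,
    polyInner_meixnerPoly h0 h1 hd, if_pos rfl, ← mul_assoc, ← C_mul]
  congr 2
  have e : (n.factorial / (-d) ^ n * (n.factorial / (-d) ^ n * (q : ℝ)⁻¹ ^ n)) =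
      (n.factorial / d ^ n * (√(q : ℝ) ^ n)⁻¹) ^ 2 := by
    have hs : ((√(q : ℝ) ^ n)⁻¹) ^ 2 = (q : ℝ)⁻¹ ^ n := by
      rw [← inv_pow, ← pow_mul, mul_comm, pow_mul, inv_pow (√(q : ℝ)), Real.sq_sqrt h0.le]
    have hn : ((-1 : ℝ) ^ n) ^ 2 = 1 := by rw [← pow_mul, mul_comm, pow_mul]; simp
    rw [mul_pow, hs, neg_pow d]
    have : (-1 : ℝ) ^ n ≠ 0 := pow_ne_zero _ (by norm_num)
    field_simp
    rw [hn]
  have hq := Real.sqrt_pos.2 h0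
  rw [e, Real.sqrt_sq (by positivity), neg_pow d]
  have hn : ((-1 : ℝ) ^ n) * (-1) ^ n = 1 := by rw [← mul_pow]; simp
  have hn0 : (-1 : ℝ) ^ n ≠ 0 := pow_ne_zero _ (by norm_num)
  have : (n.factorial : ℝ) ≠ 0 := by positivity
  field_simp
  linear_combination -hn

theorem meixnerPoly_leadingCoeff {d : ℝ} (hd : d ≠ 0) (n : ℕ) :
    (meixnerPoly d 0 n).leadingCoeff = (-d) ^ n / n.factorial := by
  have hn : (n.factorial : ℝ) ≠ 0 := by positivity
  have hdn : (-d) ^ n ≠ 0 := pow_ne_zero _ (neg_ne_zero.2 hd)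
  have h := degree_X_pow_sub_meixnerPoly hd n
  have h2 := leadingCoeff_sub_of_degree_lt (p := X ^ n)
    (q := X ^ n - C (n.factorial / (-d) ^ n) * meixnerPoly d 0 n) (by rwa [degree_X_pow])
  rw [sub_sub_cancel, leadingCoeff_mul, leadingCoeff_C, leadingCoeff_X_pow] at h2
  field_simp at h2 ⊢
  exact h2

/-! ### Christoffel–Darboux and the one-point function -/

/-- Agreement at all natural numbers forces equality of polynomials; the polynomial form can be
differentiated, as the diagonal Christoffel–Darboux formula requires. -/
theorem meixnerPoly_recurrence (d : ℝ) (n : ℕ) :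
    C ((n : ℝ) + 2) * meixnerPoly d 0 (n + 2) =
      (C (2 * n + 3 + (n + 1) * d) - C d * X) * meixnerPoly d 0 (n + 1) -
        C ((n + 1) * (1 + d)) * meixnerPoly d 0 n := by
  refine eq_of_infinite_eval_eq _ _
    ((Set.infinite_range_of_injective (Nat.cast_injective (R := ℝ))).mono ?_)
  rintro _ ⟨x, rfl⟩
  simp only [Set.mem_ofPred_eq, eval_mul, eval_sub, eval_C, eval_X, meixnerPoly_eval]
  exact meixner_recurrence d n x

theorem meixnerPoly_zero (d : ℝ) : meixnerPoly d 0 0 = 1 := by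
  simp [meixnerPoly, binomPoly]

theorem meixnerPoly_one (d : ℝ) : meixnerPoly d 0 1 = 1 - C d * X := by
  simp [meixnerPoly, binomPoly, Finset.sum_range_succ, sub_eq_add_neg]

/-- The Christoffel–Darboux formula on the diagonal. -/
theorem sum_meixnerPoly_sq {c d : ℝ} (h0 : c ≠ 0) (hd : 1 + d = c⁻¹) (n : ℕ) (x : ℝ) :
    d * ∑ m ∈ Finset.range (n + 1), c ^ m * (meixnerPoly d 0 m).eval x ^ 2 =
      -((n + 1) * c ^ n *
        ((derivative (meixnerPoly d 0 (n + 1))).eval x * (meixnerPoly d 0 n).eval x -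
          (derivative (meixnerPoly d 0 n)).eval x * (meixnerPoly d 0 (n + 1)).eval x)) := by
  induction n with
  | zero => simp [meixnerPoly_zero, meixnerPoly_one]
  | succ n ih =>
    have hr := meixnerPoly_recurrence d n
    have e1 := congrArg (fun f => eval x f) hr
    have e2 := congrArg (fun f => eval x (derivative f)) hr
    simp only [derivative_mul, derivative_sub, derivative_C, derivative_X, eval_mul, eval_sub,
      eval_add, eval_neg, eval_C, eval_X, zero_mul, zero_add, mul_one, zero_sub] at e1 e2
    have hc : c ^ (n + 1) * (1 + d) = c ^ n := by rw [hd, pow_succ]; field_simp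
    rw [Finset.sum_range_succ, mul_add, ih]
    push_cast
    set a := eval x (meixnerPoly d 0 n)
    set b := eval x (meixnerPoly d 0 (n + 1))
    set a' := eval x (derivative (meixnerPoly d 0 n))
    set b' := eval x (derivative (meixnerPoly d 0 (n + 1)))
    -- A Wronskian: in (differentiated recurrence) `* b` minus (recurrence) `* b'` the linear
    -- coefficient survives only as `-d * b ^ 2`, the new term of the sum.
    linear_combination c ^ (n + 1) * b * e2 - c ^ (n + 1) * b' * e1 +
      (n + 1) * (b' * a - a' * b) * hc

theorem kernel_self {q : unitInterval} (h0 : 0 < (q : ℝ)) (h1 : (q : ℝ) < 1) {d : ℝ}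
    (hd : 1 + d = (q : ℝ)⁻¹) (hd0 : 0 < d) {N : ℕ} (hN : 0 < N) (x : ℕ) :
    kernel q N x x = ∑ n ∈ Finset.range N, (q : ℝ) ^ n * meixner d 0 n x ^ 2 := by
  obtain ⟨n, rfl⟩ : ∃ n, N = n + 1 := ⟨N - 1, by omega⟩
  have h := sum_meixnerPoly_sq h0.ne' hd n x
  simp only [meixnerPoly_eval] at h
  rw [← mul_right_inj' hd0.ne', h, kernel, cdQuotient, if_pos rfl, Nat.add_sub_cancel]
  simp only [orthoPoly_eq h0 h1 hd hd0, leadingCoeff_mul, leadingCoeff_C,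
    meixnerPoly_leadingCoeff hd0.ne', derivative_C_mul, eval_mul, eval_C, meixnerPoly_eval]
  have hs : √(q : ℝ) ^ 2 = q := Real.sq_sqrt h0.le
  have hq := (Real.sqrt_pos.2 h0).ne'
  have hn0 : (-1 : ℝ) ^ n ≠ 0 := pow_ne_zero _ (by norm_num)
  have hn : ((-1 : ℝ) ^ n) * (-1) ^ n = 1 := by rw [← mul_pow]; simp
  have hfac : (n.factorial : ℝ) ≠ 0 := by positivity
  rw [Nat.factorial_succ, pow_succ (-1 : ℝ) n, pow_succ (√(q : ℝ)) n, pow_succ (-d) n,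
    neg_pow d n]
  have hqn : (q : ℝ) ^ n = √(q : ℝ) ^ n * √(q : ℝ) ^ n := by
    rw [← mul_pow, ← pow_two, hs]
  rw [hqn]
  push_cast
  field_simp
  have hn2 : ((-1 : ℝ) ^ n) ^ 2 = 1 := by rw [pow_two]; exact hn
  simp only [hn2]
  ring

theorem geo_singleton {q : unitInterval} (h1 : (q : ℝ) < 1) (x : ℕ) :
    geo q {x} = ENNReal.ofReal ((q : ℝ) ^ x * (1 - q)) := by
  rw [geo, geometricMeasure_singleton (symm_ne_zero h1)]
  simp

/-- The case `r = 1` of the determinantal property: embeddings of `Fin 1` landing at `x` count the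
particles at `x`. -/
theorem meanEmpirical_singleton {q : unitInterval} (h0 : 0 < (q : ℝ)) (h1 : (q : ℝ) < 1) {d : ℝ}
    (hd : 1 + d = (q : ℝ)⁻¹) (hd0 : 0 < d) {N : ℕ} (hN : 0 < N) {Q : Measure (Fin N → ℕ)}
    (hQ : IsEnsemble q N Q) (x : ℕ) :
    (meanEmpirical Q).real {x} = (N : ℝ)⁻¹ *
      ((∑ n ∈ Finset.range N, (q : ℝ) ^ n * meixner d 0 n x ^ 2) * ((q : ℝ) ^ x * (1 - q))) := by
  have hcard : ∀ l : Fin N → ℕ, (∑ i, Measure.dirac (l i)) {x} =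
      (Nat.card {e : Fin 1 ↪ Fin N // ∀ j, l (e j) = (fun _ => x : Fin 1 → ℕ) j} : ℝ≥0∞) := by
    intro l
    have e : {e : Fin 1 ↪ Fin N // ∀ j, l (e j) = (fun _ => x : Fin 1 → ℕ) j} ≃
        {i : Fin N // l i = x} :=
      Equiv.uniqueEmbeddingEquivResult.subtypeEquiv fun e => by
        rw [Unique.forall_iff]; rfl
    rw [Nat.card_congr e, Nat.card_eq_fintype_card, Fintype.card_subtype,
      Measure.finsetSum_apply, Finset.card_filter]
    push_cast
    refine Finset.sum_congr rfl fun i _ => ?_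
    rw [Measure.dirac_apply' _ (measurableSet_singleton x), Set.indicator_apply]
    simp
  -- Nonnegativity is needed because `ENNReal.ofReal` truncates negative values.
  have hker : 0 ≤ kernel q N x x := by
    rw [kernel_self h0 h1 hd hd0 hN]
    positivity
  have hmain : meanEmpirical Q {x} =
      (N : ℝ≥0∞)⁻¹ * (ENNReal.ofReal (kernel q N x x) * geo q {x}) := by
    have h := hQ.isDeterminantal 1 (fun _ => x)
    simp only [Matrix.det_unique, Matrix.of_apply, Finset.prod_const, Finset.card_univ,
      Fintype.card_fin, pow_one] at h
    rw [meanEmpirical, Measure.bind_apply (measurableSet_singleton x)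
      (Measurable.of_discrete).aemeasurable, ← h, ← lintegral_const_mul _ Measurable.of_discrete]
    refine lintegral_congr fun l => ?_
    rw [Measure.smul_apply, smul_eq_mul, hcard]
  rw [Measure.real, hmain, geo_singleton h1, kernel_self h0 h1 hd hd0 hN] at *
  rw [ENNReal.toReal_mul, ENNReal.toReal_mul, ENNReal.toReal_ofReal hker,
    ENNReal.toReal_ofReal (mul_nonneg (pow_nonneg h0.le _) (by linarith)), ENNReal.toReal_inv,
    ENNReal.toReal_natCast]

/-! ### Ledoux's formula -/

/-- The factorial moments of the squares of the Meixner polynomials. -/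
theorem hasSum_descFactorial_mul_meixner_sq (k n : ℕ) {c d : ℝ} (h0 : 0 < c) (h1 : c < 1)
    (hd : 1 + d = c⁻¹) :
    HasSum (fun x : ℕ => (x.descFactorial k : ℝ) *
        (c ^ n * meixner d 0 n x ^ 2 * (c ^ x * (1 - c))))
      (k.factorial * c ^ k * (1 - c)⁻¹ ^ k * ∑ i ∈ Finset.range (n + 1),
        (k.choose i : ℝ) ^ 2 * c⁻¹ ^ i * (n - i + k).choose k) := by
  rw [← hasSum_nat_add_iff' k]
  have hz : ∑ x ∈ Finset.range k, (x.descFactorial k : ℝ) *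
      (c ^ n * meixner d 0 n x ^ 2 * (c ^ x * (1 - c))) = 0 := by
    refine Finset.sum_eq_zero fun x hx => ?_
    rw [Nat.descFactorial_eq_zero_iff_lt.2 (Finset.mem_range.1 hx)]
    simp
  rw [hz, sub_zero]
  -- The connection coefficients, with `1 + d = c⁻¹`.
  set a : ℕ → ℝ := fun i => (k.choose i : ℝ) * (-c⁻¹) ^ i with ha
  have hterm : ∀ y : ℕ, ((y + k).descFactorial k : ℝ) *
      (c ^ n * meixner d 0 n (y + k) ^ 2 * (c ^ (y + k) * (1 - c))) =
      ∑ i ∈ Finset.range (n + 1), ∑ j ∈ Finset.range (n + 1),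
        (k.factorial * c ^ k * (c ^ n * (1 - c)) * (a i * a j)) *
        (((y + k).choose k : ℝ) * c ^ y * (meixner d k (n - i) y * meixner d k (n - j) y)) := by
    intro y
    rw [meixner_shift_iterate, hd, zero_add, Finset.Nat.sum_antidiagonal_eq_sum_range_succ_mk, sq,
      Finset.sum_mul_sum, Finset.mul_sum, Finset.sum_mul, Finset.mul_sum]
    refine Finset.sum_congr rfl fun i _ => ?_
    rw [Finset.mul_sum, Finset.sum_mul, Finset.mul_sum]
    refine Finset.sum_congr rfl fun j _ => ?_
    rw [Nat.descFactorial_eq_factorial_mul_choose, pow_add]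
    push_cast
    simp only [ha]
    ring
  have hs : HasSum (fun y : ℕ => ((y + k).descFactorial k : ℝ) *
      (c ^ n * meixner d 0 n (y + k) ^ 2 * (c ^ (y + k) * (1 - c))))
      (∑ i ∈ Finset.range (n + 1), ∑ j ∈ Finset.range (n + 1),
        (k.factorial * c ^ k * (c ^ n * (1 - c)) * (a i * a j)) *
        (if n - i = n - j then ((n - i + k).choose k : ℝ) *
          (c⁻¹ ^ (n - i) * (1 - c)⁻¹ ^ (k + 1)) else 0)) := by
    simp only [hterm]
    refine hasSum_sum fun i _ => hasSum_sum fun j _ => HasSum.mul_left _ ?_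
    rw [← tsum_meixner_mul k (n - i) (n - j) h0 h1 hd]
    exact (summable_meixner_mul d k (n - i) (n - j) h0.le h1).hasSum
  convert! hs using 1
  rw [Finset.mul_sum]
  refine Finset.sum_congr rfl fun i hi => ?_
  have hin : i ≤ n := by have := Finset.mem_range.1 hi; omega
  -- Since `i, j ≤ n`, the degrees `n - i` and `n - j` agree only for `i = j`, so the double sum is
  -- diagonal.
  rw [Finset.sum_eq_single i]
  · rw [if_pos rfl]
    have hc1 : (1 - c) ≠ 0 := by linarith
    have e1 : c ^ n * c⁻¹ ^ (n - i) * c⁻¹ ^ i = 1 := by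
      rw [mul_assoc, ← pow_add, Nat.sub_add_cancel hin, ← mul_pow, mul_inv_cancel₀ h0.ne', one_pow]
    have e2 : (1 - c) * (1 - c)⁻¹ = 1 := mul_inv_cancel₀ hc1
    have e3 : (-c⁻¹) ^ i * (-c⁻¹) ^ i = c⁻¹ ^ i * c⁻¹ ^ i := by
      rw [← mul_pow, ← mul_pow, neg_mul_neg]
    simp only [ha]
    calc _ = k.factorial * c ^ k * (1 - c)⁻¹ ^ k * ((k.choose i : ℝ) ^ 2 * c⁻¹ ^ i *
          ((n - i + k).choose k : ℝ)) * (c ^ n * c⁻¹ ^ (n - i) * c⁻¹ ^ i) *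
          ((1 - c) * (1 - c)⁻¹) := by rw [e1, e2]; ring
      _ = k.factorial * c ^ k * (1 - c)⁻¹ ^ k * ((k.choose i : ℝ) ^ 2 *
          ((n - i + k).choose k : ℝ)) * (c ^ n * c⁻¹ ^ (n - i) * (c⁻¹ ^ i * c⁻¹ ^ i)) *
          ((1 - c) * (1 - c)⁻¹) := by ring
      _ = _ := by rw [← e3]; ring
  · intro j hj hji
    have : j ≤ n := by have := Finset.mem_range.1 hj; omega
    rw [if_neg (by omega), mul_zero]
  · exact fun h => absurd hi h

/-- The hockey-stick identity in `n` for each fixed `i`. -/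
theorem sum_range_sum_choose (a : ℕ → ℝ) (k N : ℕ) :
    ∑ n ∈ Finset.range N, ∑ i ∈ Finset.range (n + 1), a i * ((n - i + k).choose k : ℝ) =
      ∑ i ∈ Finset.range N, a i * ((N - i + k).choose (k + 1) : ℝ) := by
  induction N with
  | zero => simp
  | succ N ih =>
    rw [Finset.sum_range_succ, ih, Finset.sum_range_succ (fun i => a i * ((N - i + k).choose k : ℝ)),
      ← add_assoc, ← Finset.sum_add_distrib, Finset.sum_range_succ _ N]
    congr 1
    · refine Finset.sum_congr rfl fun i hi => ?_
      have hi' := Finset.mem_range.1 hi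
      rw [show N + 1 - i + k = N - i + k + 1 by omega, Nat.choose_succ_succ]
      push_cast
      ring
    · rw [show N - N + k = k by omega, show N + 1 - N + k = k + 1 by omega]
      simp

/-- Ledoux's formula for the factorial moments of the mean empirical measure. -/
theorem hasSum_descFactorial_meanEmpirical {q : unitInterval} (h0 : 0 < (q : ℝ))
    (h1 : (q : ℝ) < 1) {N k : ℕ} (hkN : k < N) {Q : Measure (Fin N → ℕ)}
    (hQ : IsEnsemble q N Q) :
    HasSum (fun x : ℕ => (meanEmpirical Q).real {x} * (x.descFactorial k : ℝ))
      ((N : ℝ)⁻¹ * ((k : ℝ) + 1)⁻¹ * (1 - q : ℝ)⁻¹ ^ k * ∑ i ∈ Finset.range (k + 1),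
        (k.choose i : ℝ) ^ 2 * (q : ℝ) ^ (k - i) *
          ∏ j ∈ Finset.range (k + 1), ((N : ℝ) - i + j)) := by
  have hd : 1 + ((q : ℝ)⁻¹ - 1) = (q : ℝ)⁻¹ := by ring
  have hd0 : 0 < (q : ℝ)⁻¹ - 1 := by
    have := (one_lt_inv₀ h0).2 h1
    linarith
  set d := (q : ℝ)⁻¹ - 1
  have h := (hasSum_sum (s := Finset.range N) fun n _ =>
    hasSum_descFactorial_mul_meixner_sq k n h0 h1 hd).mul_left (N : ℝ)⁻¹
  convert! h using 1
  · funext x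
    rw [meanEmpirical_singleton h0 h1 hd hd0 (by omega) hQ, ← Finset.mul_sum, Finset.sum_mul]
    ring
  · rw [← Finset.mul_sum, sum_range_sum_choose, mul_assoc, mul_assoc]
    congr 1
    rw [Finset.mul_sum, Finset.mul_sum, Finset.mul_sum]
    -- The terms with `i > k` vanish, and `k < N` guarantees that none with `i ≤ k` is missing.
    rw [← Finset.sum_subset (Finset.range_mono (show k + 1 ≤ N by omega))]
    · refine Finset.sum_congr rfl fun i hi => ?_
      have hik : i ≤ k := by have := Finset.mem_range.1 hi; omega
      have hp : ∏ j ∈ Finset.range (k + 1), ((N : ℝ) - i + j) =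
          (k + 1) * k.factorial * (N - i + k).choose (k + 1) := by
        have h2 := Nat.ascFactorial_eq_factorial_mul_choose' (N - i) (k + 1)
        rw [Nat.ascFactorial_eq_prod_range, Nat.factorial_succ] at h2
        have h3 := congrArg (Nat.cast (R := ℝ)) h2
        push_cast at h3
        rw [Nat.cast_sub (by omega)] at h3
        rw [h3, show N - i + (k + 1) - 1 = N - i + k by omega]
      have hq : (q : ℝ) ^ k * (q : ℝ)⁻¹ ^ i = (q : ℝ) ^ (k - i) := by
        rw [← Nat.sub_add_cancel hik, pow_add, mul_assoc, ← mul_pow, mul_inv_cancel₀ h0.ne']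
        simp
      rw [hp, ← hq]
      have hk : (k : ℝ) + 1 ≠ 0 := by positivity
      field_simp
    · intro i _ hi
      rw [Finset.mem_range, not_lt] at hi
      rw [Nat.choose_eq_zero_of_lt (by omega)]
      simp

theorem integrable_and_integral_eq {μ : Measure ℕ} [IsFiniteMeasure μ] {f : ℕ → ℝ}
    (hf : ∀ x, 0 ≤ f x) {s : ℝ} (h : HasSum (fun x => μ.real {x} * f x) s) :
    Integrable f μ ∧ ∫ x, f x ∂μ = s := by
  have hi : Integrable f μ := by
    rw [← Measure.sum_smul_dirac μ, integrable_sum_dirac_iff fun x => measure_ne_top _ _]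
    refine h.summable.congr fun x => ?_
    rw [Real.norm_of_nonneg (hf x), measureReal_def]
  exact ⟨hi, by rw [integral_countable hi, ← h.tsum_eq]; rfl⟩

theorem isFiniteMeasure_meanEmpirical {N : ℕ} (hN : 0 < N) {Q : Measure (Fin N → ℕ)}
    [IsProbabilityMeasure Q] : IsFiniteMeasure (meanEmpirical Q) := by
  refine ⟨?_⟩
  have hN' : (N : ℝ≥0∞) ≠ 0 := by exact_mod_cast hN.ne'
  rw [meanEmpirical, Measure.bind_apply MeasurableSet.univ (Measurable.of_discrete).aemeasurable]
  simp [Measure.finsetSum_apply, ENNReal.inv_mul_cancel hN' (ENNReal.natCast_ne_top N)]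

/-! ### Size of the sums of squared binomial coefficients -/

/-- The recursion for central binomial coefficients reduces the induction to `(2 j + 3) (2 j + 1) ≤
(2 j + 2) ^ 2`. -/
theorem centralBinom_sq_le (j : ℕ) : (2 * j + 1) * (j.centralBinom : ℝ) ^ 2 ≤ 16 ^ j := by
  induction j with
  | zero => simp
  | succ j ih =>
    have h := congrArg (Nat.cast (R := ℝ)) (Nat.succ_mul_centralBinom_succ j)
    push_cast at h
    have hj : (0 : ℝ) < (j + 1) ^ 2 := by positivity
    rw [← mul_le_mul_iff_of_pos_left hj]
    push_cast
    calc ((j : ℝ) + 1) ^ 2 * ((2 * (j + 1) + 1) * ((j + 1).centralBinom : ℝ) ^ 2)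
        = (2 * (j + 1) + 1) * (((j : ℝ) + 1) * ((j + 1).centralBinom : ℝ)) ^ 2 := by ring
      _ = (4 * (2 * (j + 1) + 1) * (2 * j + 1)) * ((2 * j + 1) * (j.centralBinom : ℝ) ^ 2) := by
          rw [h]; ring
      _ ≤ (4 * (2 * (j + 1) + 1) * (2 * j + 1)) * 16 ^ j := by gcongr
      _ ≤ (16 * ((j : ℝ) + 1) ^ 2) * 16 ^ j :=
          mul_le_mul_of_nonneg_right (by nlinarith) (by positivity)
      _ = ((j : ℝ) + 1) ^ 2 * 16 ^ (j + 1) := by ring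

/-- The central coefficient of `(X ^ 2 + ρ ^ 2) ^ m`. -/
theorem coeff_X_sq_add_pow (ρ : ℝ) (m : ℕ) :
    (((X ^ 2 + C (ρ ^ 2)) ^ m : ℝ[X]).coeff m) ^ 2 * (m + 1) ≤ ((2 * ρ) ^ m) ^ 2 := by
  have e : ((X ^ 2 + C (ρ ^ 2)) ^ m : ℝ[X]) = expand ℝ 2 ((X + C (ρ ^ 2)) ^ m) := by simp
  rw [e, coeff_expand two_pos]
  split_ifs with h
  · obtain ⟨j, rfl⟩ := h
    rw [Nat.mul_div_cancel_left _ two_pos, coeff_X_add_C_pow, show 2 * j - j = j by omega,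
      ← Nat.centralBinom_eq_two_mul_choose]
    calc _ = ((ρ ^ 2) ^ j) ^ 2 * ((2 * j + 1) * (j.centralBinom : ℝ) ^ 2) := by push_cast; ring
      _ ≤ ((ρ ^ 2) ^ j) ^ 2 * 16 ^ j := by gcongr; exact centralBinom_sq_le j
      _ = _ := by
        rw [mul_pow, mul_pow, pow_mul 2 2 j, ← pow_mul (2 ^ 2) j 2, mul_comm j 2,
          pow_mul (2 ^ 2) 2 j, ← pow_mul ρ 2 j]
        norm_num
        ring
  · rw [sq, zero_mul, zero_mul]
    positivity

/-- Both sides are the coefficient of `X ^ k` in `((X + 1) (X + r)) ^ k = ((X ^ 2 + r) + (1 + r) X)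
^ k`. -/
theorem sum_choose_sq_eq_coeff (k : ℕ) (r : ℝ) :
    ∑ i ∈ Finset.range (k + 1), (k.choose i : ℝ) ^ 2 * r ^ i =
      ∑ m ∈ Finset.range (k + 1),
        ((X ^ 2 + C r) ^ m : ℝ[X]).coeff m * (1 + r) ^ (k - m) * k.choose m := by
  have e : ((X + C 1) * (X + C r) : ℝ[X]) = (X ^ 2 + C r) + C (1 + r) * X := by
    rw [C_add, C_1]; ring
  have h1 : (((X + C 1) * (X + C r) : ℝ[X]) ^ k).coeff k =
      ∑ i ∈ Finset.range (k + 1), (k.choose i : ℝ) ^ 2 * r ^ i := by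
    rw [mul_pow, coeff_mul, Finset.Nat.sum_antidiagonal_eq_sum_range_succ_mk]
    refine Finset.sum_congr rfl fun i hi => ?_
    have hik : i ≤ k := by have := Finset.mem_range.1 hi; omega
    simp only [coeff_X_add_C_pow]
    rw [Nat.choose_symm hik, Nat.sub_sub_self hik]
    ring
  rw [← h1, e, add_pow, finsetSum_coeff]
  refine Finset.sum_congr rfl fun m hm => ?_
  have hmk : m ≤ k := by have := Finset.mem_range.1 hm; omega
  rw [← C_eq_natCast, coeff_mul_C, mul_pow, ← C_pow, ← mul_assoc]
  obtain ⟨l, rfl⟩ := Nat.exists_eq_add_of_le hmk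
  rw [Nat.add_sub_cancel_left, coeff_mul_X_pow, coeff_mul_C]

/-- Upper bound for `∑ᵢ (k.choose i)² ρ²ⁱ`. -/
theorem sum_choose_sq_le (k : ℕ) {ρ : ℝ} (hρ : 0 < ρ) :
    (∑ i ∈ Finset.range (k + 1), (k.choose i : ℝ) ^ 2 * (ρ ^ 2) ^ i) ^ 2 * ((k + 1) * (2 * ρ)) ≤
      ((1 + ρ) ^ (2 * k) * (1 + ρ)) ^ 2 := by
  set w : ℕ → ℝ := fun m => (2 * ρ) ^ m * (1 + ρ ^ 2) ^ (k - m) * k.choose m with hw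
  have hsum : ∑ m ∈ Finset.range (k + 1), w m = (2 * ρ + (1 + ρ ^ 2)) ^ k := (add_pow _ _ _).symm
  have hw0 : ∀ m, 0 ≤ w m := fun m => by simp only [hw]; positivity
  -- The `m`-th term is at most `w m / √(m + 1)` in absolute value; Cauchy–Schwarz splits this as
  -- `√(w m) * √(w m / (m + 1))`.
  have hcs : (∑ i ∈ Finset.range (k + 1), (k.choose i : ℝ) ^ 2 * (ρ ^ 2) ^ i) ^ 2 ≤
      (∑ m ∈ Finset.range (k + 1), w m) * ∑ m ∈ Finset.range (k + 1), w m / (m + 1) := by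
    rw [sum_choose_sq_eq_coeff]
    refine Finset.sum_sq_le_sum_mul_sum_of_sq_le_mul _ (fun m _ => hw0 m)
      (fun m _ => div_nonneg (hw0 m) (by positivity)) fun m _ => ?_
    have hm : (0 : ℝ) < m + 1 := by positivity
    rw [← mul_div_assoc, le_div_iff₀ hm]
    have := mul_le_mul_of_nonneg_right (coeff_X_sq_add_pow ρ m)
      (sq_nonneg ((1 + ρ ^ 2) ^ (k - m) * (k.choose m : ℝ)))
    simp only [hw]
    linear_combination this
  -- The denominator `m + 1` is absorbed into `(k + 1).choose (m + 1)`, leaving a binomial expansion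
  -- of exponent `k + 1` without its first term.
  have hinv : (∑ m ∈ Finset.range (k + 1), w m / (m + 1)) * ((k + 1) * (2 * ρ)) ≤
      (2 * ρ + (1 + ρ ^ 2)) ^ (k + 1) := by
    rw [add_pow, Finset.sum_range_succ' _ (k + 1), Finset.sum_mul]
    refine le_add_of_le_of_nonneg (Finset.sum_le_sum fun m _ => le_of_eq ?_) (by positivity)
    have h : ((k : ℝ) + 1) * k.choose m = (k + 1).choose (m + 1) * (m + 1) := by
      exact_mod_cast Nat.add_one_mul_choose_eq k m
    have hm : (m : ℝ) + 1 ≠ 0 := by positivity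
    rw [Nat.add_sub_add_right, div_mul_eq_mul_div, div_eq_iff hm]
    simp only [hw]
    linear_combination ((2 * ρ) ^ (m + 1) * (1 + ρ ^ 2) ^ (k - m)) * h
  calc _ ≤ ((∑ m ∈ Finset.range (k + 1), w m) * ∑ m ∈ Finset.range (k + 1), w m / (m + 1)) *
        ((k + 1) * (2 * ρ)) := by gcongr
    _ = (∑ m ∈ Finset.range (k + 1), w m) * ((∑ m ∈ Finset.range (k + 1), w m / (m + 1)) *
        ((k + 1) * (2 * ρ))) := by ring
    _ ≤ (2 * ρ + (1 + ρ ^ 2)) ^ k * (2 * ρ + (1 + ρ ^ 2)) ^ (k + 1) := by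
        rw [hsum]; gcongr
    _ = _ := by
        rw [show 2 * ρ + (1 + ρ ^ 2) = (1 + ρ) ^ 2 by ring]
        generalize 1 + ρ = z
        ring

/-- The variance of the binomial law with success probability `ρ / (1 + ρ)`, unnormalised. -/
theorem sum_choose_mul_sq_sub (k : ℕ) {ρ : ℝ} (hρ : 0 < ρ) :
    ∑ i ∈ Finset.range (k + 1), (k.choose i : ℝ) * ρ ^ i * (k * (ρ / (1 + ρ)) - i) ^ 2 =
      (1 + ρ) ^ k * (k * ρ / (1 + ρ) ^ 2) := by
  have h := congrArg (eval (ρ / (1 + ρ))) (bernsteinPolynomial.variance ℝ k)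
  have hρ1 : 1 + ρ ≠ 0 := by positivity
  have e : 1 - ρ / (1 + ρ) = 1 / (1 + ρ) := by field_simp; ring
  simp only [eval_finsetSum, bernsteinPolynomial, eval_mul, eval_pow, eval_sub, eval_X,
    eval_natCast, eval_one, e, nsmul_eq_mul] at h
  have h2 := congrArg (fun t => (1 + ρ) ^ k * t) h
  rw [Finset.mul_sum] at h2
  convert! h2 using 1
  · refine Finset.sum_congr rfl fun i hi => ?_
    have hik : i ≤ k := by have := Finset.mem_range.1 hi; omega
    obtain ⟨l, rfl⟩ := Nat.exists_eq_add_of_le hik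
    rw [Nat.add_sub_cancel_left, pow_add, div_pow, div_pow, one_pow]
    field_simp
  · field_simp

theorem card_le_of_abs_sub_lt {s : Finset ℕ} {x t : ℝ} (ht : 0 ≤ t)
    (h : ∀ i ∈ s, |x - i| < 2 * t) : (s.card : ℝ) ≤ 4 * t + 1 := by
  rcases s.eq_empty_or_nonempty with rfl | hs
  · simp; linarith
  have hsub : s ⊆ Finset.Icc (s.min' hs) (s.max' hs) := fun i hi =>
    Finset.mem_Icc.2 ⟨s.min'_le i hi, s.le_max' i hi⟩
  have hc := Finset.card_le_card hsub
  rw [Nat.card_Icc] at hc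
  have hle : s.min' hs ≤ s.max' hs := s.min'_le _ (s.max'_mem hs)
  have h1 := abs_lt.1 (h _ (s.min'_mem hs))
  have h2 := abs_lt.1 (h _ (s.max'_mem hs))
  have hc' : (s.card : ℝ) + s.min' hs ≤ s.max' hs + 1 := by
    exact_mod_cast (by omega : s.card + s.min' hs ≤ s.max' hs + 1)
  linarith [h1.1, h2.2]

/-- Lower bound for `∑ᵢ (k.choose i)² ρ²ⁱ`. -/
theorem le_sum_choose_sq (k : ℕ) {ρ : ℝ} (hρ : 0 < ρ) (hk : 1 ≤ k * ρ) :
    (1 + ρ) ^ (2 * k) ≤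
      9 * √(k * ρ) * ∑ i ∈ Finset.range (k + 1), (k.choose i : ℝ) ^ 2 * (ρ ^ 2) ^ i := by
  set t := √(k * ρ) with ht
  have ht1 : 1 ≤ t := Real.one_le_sqrt.2 hk
  have ht2 : t ^ 2 = k * ρ := Real.sq_sqrt (by linarith)
  set c : ℕ → ℝ := fun i => (k.choose i : ℝ) * ρ ^ i with hc
  have hc0 : ∀ i, 0 ≤ c i := fun i => by simp only [hc]; positivity
  set x := k * (ρ / (1 + ρ))
  -- The variance is at most `t ^ 2`, so by Chebyshev this window carries at least 3/4 of the
  -- binomial mass. It has at most `4 t + 1 ≤ 5 t` points, and Cauchy–Schwarz on it bounds the sum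
  -- of squares from below.
  set s := (Finset.range (k + 1)).filter fun i : ℕ => |x - i| < 2 * t with hs
  have hsum : ∑ i ∈ Finset.range (k + 1), c i = (1 + ρ) ^ k := by
    rw [add_comm 1 ρ, add_pow]
    exact Finset.sum_congr rfl fun i _ => by simp only [hc, one_pow]; ring
  have hvar := sum_choose_mul_sq_sub k hρ
  have hsplit := Finset.sum_filter_add_sum_filter_not (Finset.range (k + 1))
    (fun i : ℕ => |x - i| < 2 * t) c
  have htail : (∑ i ∈ (Finset.range (k + 1)).filter (fun i : ℕ => ¬ |x - i| < 2 * t), c i) *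
      (4 * t ^ 2) ≤ (1 + ρ) ^ k * t ^ 2 := by
    calc _ ≤ ∑ i ∈ (Finset.range (k + 1)).filter (fun i : ℕ => ¬ |x - i| < 2 * t),
          c i * (x - i) ^ 2 := by
          rw [Finset.sum_mul]
          refine Finset.sum_le_sum fun i hi => mul_le_mul_of_nonneg_left ?_ (hc0 i)
          have := not_lt.1 (Finset.mem_filter.1 hi).2
          rw [← sq_abs (x - i)]
          nlinarith
      _ ≤ ∑ i ∈ Finset.range (k + 1), c i * (x - i) ^ 2 :=
          Finset.sum_le_sum_of_subset_of_nonneg (Finset.filter_subset _ _)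
            fun i _ _ => mul_nonneg (hc0 i) (sq_nonneg _)
      _ = (1 + ρ) ^ k * (k * ρ / (1 + ρ) ^ 2) := hvar
      _ ≤ _ := by
          rw [ht2]
          gcongr
          refine div_le_self (by linarith) ?_
          nlinarith
  have hpos : 0 < (1 + ρ) ^ k := by positivity
  have hmain : 3 / 4 * (1 + ρ) ^ k ≤ ∑ i ∈ s, c i := by
    have ht3 : 0 < t ^ 2 := by positivity
    have : (∑ i ∈ (Finset.range (k + 1)).filter (fun i : ℕ => ¬ |x - i| < 2 * t), c i) * 4 ≤
        (1 + ρ) ^ k := by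
      refine le_of_mul_le_mul_right ?_ ht3
      linarith
    linarith
  have hcs : (∑ i ∈ s, c i) ^ 2 ≤ s.card * ∑ i ∈ s, c i ^ 2 := sq_sum_le_card_mul_sum_sq
  have hcard : (s.card : ℝ) ≤ 5 * t := by
    have := card_le_of_abs_sub_lt (s := s) (x := x) (t := t) (by linarith)
      fun i hi => (Finset.mem_filter.1 hi).2
    linarith
  have hS : ∑ i ∈ s, c i ^ 2 ≤ ∑ i ∈ Finset.range (k + 1), c i ^ 2 :=
    Finset.sum_le_sum_of_subset_of_nonneg (Finset.filter_subset _ _) fun i _ _ => sq_nonneg _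
  have hSe : ∑ i ∈ Finset.range (k + 1), c i ^ 2 =
      ∑ i ∈ Finset.range (k + 1), (k.choose i : ℝ) ^ 2 * (ρ ^ 2) ^ i :=
    Finset.sum_congr rfl fun i _ => by simp only [hc]; ring
  rw [← hSe]
  have hS0 : 0 ≤ ∑ i ∈ Finset.range (k + 1), c i ^ 2 := Finset.sum_nonneg fun i _ => sq_nonneg _
  have h1 : (3 / 4 * (1 + ρ) ^ k) ^ 2 ≤ 5 * t * ∑ i ∈ Finset.range (k + 1), c i ^ 2 :=
    calc _ ≤ (∑ i ∈ s, c i) ^ 2 := by gcongr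
      _ ≤ _ := hcs
      _ ≤ _ := by gcongr
  have h2 : (1 + ρ) ^ (2 * k) = ((1 + ρ) ^ k) ^ 2 := by ring
  rw [h2]
  -- The constant is `5 * (4/3) ^ 2 = 80/9 ≤ 9`.
  nlinarith [mul_nonneg (by linarith : 0 ≤ t) hS0]

/-! ### Exponential approximation and tilting -/

theorem exp_le_one_add_add_sq {x : ℝ} (hx : |x| ≤ 1) : Real.exp x ≤ 1 + x + x ^ 2 := by
  have := (abs_le.1 (Real.abs_exp_sub_one_sub_id_le hx)).2
  linarith

theorem exp_sub_two_mul_sq_le {x : ℝ} (hx : |x| ≤ 1 / 5) : Real.exp (x - 2 * x ^ 2) ≤ 1 + x := by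
  obtain ⟨h1, h2⟩ := abs_le.1 hx
  have hy : |x - 2 * x ^ 2| ≤ 1 := abs_le.2 ⟨by nlinarith, by nlinarith⟩
  refine (exp_le_one_add_add_sq hy).trans ?_
  -- The source of the threshold `1/5`: with `y = x - 2 x ^ 2`, the term `y ^ 2 = x ^ 2 (1 - 2 x) ^
  -- 2` must not exceed `2 x ^ 2`.
  have h3 : (1 - 2 * x) ^ 2 ≤ 2 := by nlinarith
  nlinarith [mul_le_mul_of_nonneg_left h3 (sq_nonneg x)]

theorem sum_range_sub_div (N : ℝ) (k i : ℕ) :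
    ∑ j ∈ Finset.range (k + 1), ((j : ℝ) - i) / N = (k + 1) * (k - 2 * i) / (2 * N) := by
  have h : ∑ j ∈ Finset.range (k + 1), (j : ℝ) = (k + 1) * k / 2 := by
    have := congrArg (Nat.cast (R := ℝ)) (Finset.sum_range_id_mul_two (k + 1))
    rw [Nat.add_sub_cancel] at this
    push_cast at this
    linarith
  rw [← Finset.sum_div, Finset.sum_sub_distrib, h]
  simp only [Finset.sum_const, Finset.card_range, nsmul_eq_mul]
  push_cast
  rw [← div_div]
  ring

theorem prod_eq_pow_mul_prod {N : ℝ} (hN : 0 < N) (k i : ℕ) :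
    ∏ j ∈ Finset.range (k + 1), (N - i + j) =
      N ^ (k + 1) * ∏ j ∈ Finset.range (k + 1), (1 + ((j : ℝ) - i) / N) := by
  rw [← Finset.card_range (k + 1), ← Finset.prod_const, Finset.card_range,
    ← Finset.prod_mul_distrib]
  refine Finset.prod_congr rfl fun j _ => ?_
  field_simp
  ring

theorem abs_sub_div_le {N : ℝ} (hN : 0 < N) {i j k : ℕ} (hi : i ≤ k) (hj : j ≤ k) :
    |((j : ℝ) - i) / N| ≤ k / N := by
  rw [abs_div, abs_of_pos hN]
  have hi' : (i : ℝ) ≤ k := by exact_mod_cast hi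
  have hj' : (j : ℝ) ≤ k := by exact_mod_cast hj
  gcongr
  refine abs_le.2 ⟨?_, ?_⟩ <;> linarith [(Nat.cast_nonneg i : (0 : ℝ) ≤ i),
    (Nat.cast_nonneg j : (0 : ℝ) ≤ j)]

theorem prod_le_exp {N : ℝ} (hN : 0 < N) {k i : ℕ} (hi : i ≤ k) (hkN : k / N ≤ 1 / 5) :
    ∏ j ∈ Finset.range (k + 1), (N - i + j) ≤
      N ^ (k + 1) * Real.exp ((k + 1) * (k - 2 * i) / (2 * N)) := by
  rw [prod_eq_pow_mul_prod hN, ← sum_range_sub_div, Real.exp_sum]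
  refine mul_le_mul_of_nonneg_left (Finset.prod_le_prod (fun j hj => ?_) fun j _ => ?_)
    (by positivity)
  · have hj' : j ≤ k := by have := Finset.mem_range.1 hj; omega
    linarith [(abs_le.1 ((abs_sub_div_le hN hi hj').trans hkN)).1]
  · rw [add_comm]
    exact Real.add_one_le_exp _

theorem exp_le_prod {N : ℝ} (hN : 0 < N) {k i : ℕ} (hi : i ≤ k) (hkN : k / N ≤ 1 / 5) :
    N ^ (k + 1) * Real.exp ((k + 1) * (k - 2 * i) / (2 * N)) *
        Real.exp (-(2 * (k + 1) * (k / N) ^ 2)) ≤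
      ∏ j ∈ Finset.range (k + 1), (N - i + j) := by
  rw [prod_eq_pow_mul_prod hN, mul_assoc, ← Real.exp_add]
  refine mul_le_mul_of_nonneg_left ?_ (by positivity)
  calc _ ≤ Real.exp (∑ j ∈ Finset.range (k + 1),
        (((j : ℝ) - i) / N - 2 * (((j : ℝ) - i) / N) ^ 2)) := by
        rw [Real.exp_le_exp, Finset.sum_sub_distrib, sum_range_sub_div, ← sub_eq_add_neg]
        refine sub_le_sub_left ?_ _
        calc _ ≤ ∑ j ∈ Finset.range (k + 1), 2 * ((k : ℝ) / N) ^ 2 := by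
              refine Finset.sum_le_sum fun j hj => ?_
              have hj' : j ≤ k := by have := Finset.mem_range.1 hj; omega
              have := sq_le_sq' (abs_le.1 (abs_sub_div_le hN hi hj')).1
                (abs_le.1 (abs_sub_div_le hN hi hj')).2
              linarith
          _ = _ := by
              simp only [Finset.sum_const, Finset.card_range, nsmul_eq_mul]
              push_cast
              ring
    _ ≤ _ := by
        rw [Real.exp_sum]
        refine Finset.prod_le_prod (fun j _ => (Real.exp_pos _).le) fun j hj => ?_
        have hj' : j ≤ k := by have := Finset.mem_range.1 hj; omega
        exact exp_sub_two_mul_sq_le ((abs_sub_div_le hN hi hj').trans hkN)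

/-- `log (1 + a * exp s)` has slope `a / (1 + a)` at `s = 0`; its second-order error is at most `s ^
2`, uniformly in `a`. -/
theorem one_add_mul_exp_le {a s : ℝ} (ha : 0 ≤ a) (hs0 : 0 ≤ s) (hs1 : s ≤ 1) :
    1 + a * Real.exp s ≤ (1 + a) * Real.exp (a / (1 + a) * s + s ^ 2) := by
  have h1 := exp_le_one_add_add_sq (abs_le.2 ⟨by linarith, hs1⟩)
  have ha1 : 0 < 1 + a := by linarith
  have hp : a / (1 + a) ≤ 1 := (div_le_one ha1).2 (by linarith)
  have h2 := Real.add_one_le_exp (a / (1 + a) * (s + s ^ 2))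
  calc 1 + a * Real.exp s ≤ 1 + a * (1 + s + s ^ 2) := by gcongr
    _ = (1 + a) * (a / (1 + a) * (s + s ^ 2) + 1) := by field_simp; ring
    _ ≤ (1 + a) * Real.exp (a / (1 + a) * (s + s ^ 2)) := by gcongr
    _ ≤ _ := by
      gcongr
      nlinarith [sq_nonneg s]

/-- Jensen for `exp` at the points `s` and `0` with weights `a / (1 + a)` and `1 / (1 + a)`. -/
theorem le_one_add_mul_exp {a : ℝ} (ha : 0 ≤ a) (s : ℝ) :
    (1 + a) * Real.exp (a / (1 + a) * s) ≤ 1 + a * Real.exp s := by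
  have ha1 : 0 < 1 + a := by linarith
  have h := convexOn_exp.2 (Set.mem_univ s) (Set.mem_univ 0) 
    (show 0 ≤ a / (1 + a) by positivity) (show 0 ≤ 1 / (1 + a) by positivity)
    (by field_simp; ring)
  simp only [smul_eq_mul, mul_zero, add_zero, Real.exp_zero, mul_one] at h
  calc _ ≤ (1 + a) * (a / (1 + a) * Real.exp s + 1 / (1 + a)) := by gcongr
    _ = _ := by field_simp; ring

theorem rpow_size {q k : ℝ} (hq : 0 < q) (hk : 0 < k) :
    (q ^ (1 / 6 : ℝ) * k) ^ (-(3 / 2) : ℝ) = (k * √(k * √q))⁻¹ := by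
  rw [Real.sqrt_mul hk.le, Real.sqrt_eq_rpow, Real.sqrt_eq_rpow, Real.sqrt_eq_rpow,
    ← Real.rpow_mul hq.le, Real.mul_rpow (by positivity) hk.le, ← Real.rpow_mul hq.le, ← mul_assoc,
    mul_inv, ← Real.rpow_neg hq.le]
  have : k * k ^ (1 / 2 : ℝ) = k ^ (3 / 2 : ℝ) := by
    rw [← Real.rpow_one_add' hk.le (by norm_num)]; norm_num
  rw [this, ← Real.rpow_neg hk.le, mul_comm]
  norm_num

theorem edge_eq {q : ℝ} (h0 : 0 ≤ q) (h1 : q < 1) : edge q = (1 + √q) / (1 - √q) := by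
  have ha1 : √q < 1 := by rwa [Real.sqrt_lt' one_pos, one_pow]
  have e : 1 - q = (1 - √q) * (1 + √q) := by linear_combination Real.sq_sqrt h0
  have h2 : 1 - √q ≠ 0 := by linarith
  have h3 : 1 + √q ≠ 0 := by positivity
  rw [edge, e]
  field_simp

theorem momentSize_eq {q : ℝ} (h0 : 0 < q) {N k : ℕ} (hk : 0 < k) :
    momentSize q N k = (k * √(k * √q))⁻¹ * ((N : ℝ) ^ k * (1 - q)⁻¹ ^ k *
      ((1 + √q) ^ (2 * k) * Real.exp (-((k : ℝ) ^ 2 / (2 * edge q * N))))) := by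
  rw [momentSize, rpow_size h0 (by exact_mod_cast hk), edge, mul_pow, div_pow, inv_pow, pow_mul]
  ring

/-- The exponential tilting of the binomial sums in Ledoux's formula. -/
theorem tilt_bounds {q N : ℝ} (h0 : 0 < q) (h1 : q < 1) (hN : 0 < N) {k : ℕ} (hk : 0 < k)
    (hkN : k / N ≤ 1 / 5) :
    (1 + √q) ^ (2 * k) * Real.exp (-((k : ℝ) ^ 2 / (2 * edge q * N))) ≤
        2 * ((1 + √q * Real.exp ((k + 1) / (2 * N))) ^ (2 * k) *
          Real.exp (-((k + 1) / (2 * N) * k))) ∧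
      (1 + √q * Real.exp ((k + 1) / (2 * N))) ^ (2 * k) * Real.exp (-((k + 1) / (2 * N) * k)) ≤
        (1 + √q) ^ (2 * k) * Real.exp (-((k : ℝ) ^ 2 / (2 * edge q * N))) *
          Real.exp (2 * k * ((k + 1) / (2 * N)) ^ 2) := by
  have ha0 : 0 < √q := Real.sqrt_pos.2 h0
  have ha1 : √q < 1 := by rwa [Real.sqrt_lt' one_pos, one_pow]
  set a := √q
  set s := (k + 1) / (2 * N) with hs
  have hk1 : (1 : ℝ) ≤ k := by exact_mod_cast hk
  have hs0 : 0 ≤ s := by positivity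
  have hs1 : s ≤ 1 := by
    rw [hs, div_le_one (by positivity)]
    rw [div_le_iff₀ hN] at hkN
    linarith
  have ha2 : 1 - a ≠ 0 := by linarith
  have ha3 : 1 + a ≠ 0 := by linarith
  -- The last term comes from `k + 1` replacing `k` in `s`; it lies in `[0, 1/2]`, hence costs at
  -- most a factor `2`.
  have hexp : (2 * k : ℕ) * (a / (1 + a) * s) + -(s * k) =
      -((k : ℝ) ^ 2 / (2 * edge q * N)) - k / N * ((1 - a) / (2 * (1 + a))) := by
    rw [edge_eq h0.le h1, hs]
    push_cast
    field_simp
    ring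
  have hr0 : 0 ≤ k / N * ((1 - a) / (2 * (1 + a))) :=
    mul_nonneg (by positivity) (div_nonneg (by linarith) (by linarith))
  have hr1 : k / N * ((1 - a) / (2 * (1 + a))) ≤ 1 / 2 := by
    have : (1 - a) / (2 * (1 + a)) ≤ 1 := by rw [div_le_one (by linarith)]; linarith
    calc _ ≤ k / N * 1 := by gcongr
      _ ≤ _ := by linarith
  set r := k / N * ((1 - a) / (2 * (1 + a)))
  set E := -((k : ℝ) ^ 2 / (2 * edge q * N))
  constructor
  · have h := pow_le_pow_left₀ (by positivity) (le_one_add_mul_exp ha0.le s) (2 * k)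
    have hhalf : Real.exp E ≤ 2 * Real.exp (E - r) := by
      have h2 : 1 ≤ 2 * Real.exp (-r) := by linarith [Real.add_one_le_exp (-r)]
      rw [sub_eq_add_neg, Real.exp_add]
      nlinarith [Real.exp_pos E]
    calc (1 + a) ^ (2 * k) * Real.exp E ≤ (1 + a) ^ (2 * k) * (2 * Real.exp (E - r)) := by gcongr
      _ = 2 * (((1 + a) * Real.exp (a / (1 + a) * s)) ^ (2 * k) * Real.exp (-(s * k))) := by
        rw [mul_pow, ← Real.exp_nat_mul, mul_assoc ((1 + a) ^ (2 * k)), ← Real.exp_add, hexp]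
        ring
      _ ≤ _ := by gcongr
  · have h := pow_le_pow_left₀ (by positivity) (one_add_mul_exp_le ha0.le hs0 hs1) (2 * k)
    calc _ ≤ ((1 + a) * Real.exp (a / (1 + a) * s + s ^ 2)) ^ (2 * k) * Real.exp (-(s * k)) := by
          gcongr
      _ = (1 + a) ^ (2 * k) * (Real.exp (E - r) * Real.exp (2 * k * s ^ 2)) := by
          rw [mul_pow, ← Real.exp_nat_mul, mul_assoc, ← Real.exp_add, ← Real.exp_add, ← hexp]
          congr 2
          push_cast
          ring
      _ ≤ (1 + a) ^ (2 * k) * (Real.exp E * Real.exp (2 * k * s ^ 2)) := by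
          gcongr
          linarith
      _ = _ := by ring

/-- Comparison of the sums in Ledoux's formula with tilted sums of squared binomial
coefficients. -/
theorem ledoux_sum_bounds {q N : ℝ} (h0 : 0 ≤ q) (hN : 0 < N) {k : ℕ} (hkN : k / N ≤ 1 / 5) :
    N ^ (k + 1) * (Real.exp (-((k + 1) / (2 * N) * k)) *
        ∑ i ∈ Finset.range (k + 1),
          (k.choose i : ℝ) ^ 2 * ((√q * Real.exp ((k + 1) / (2 * N))) ^ 2) ^ i) *
        Real.exp (-(2 * (k + 1) * (k / N) ^ 2)) ≤
      ∑ i ∈ Finset.range (k + 1),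
        (k.choose i : ℝ) ^ 2 * q ^ (k - i) * ∏ j ∈ Finset.range (k + 1), (N - i + j) ∧
    ∑ i ∈ Finset.range (k + 1),
        (k.choose i : ℝ) ^ 2 * q ^ (k - i) * ∏ j ∈ Finset.range (k + 1), (N - i + j) ≤
      N ^ (k + 1) * (Real.exp (-((k + 1) / (2 * N) * k)) *
        ∑ i ∈ Finset.range (k + 1),
          (k.choose i : ℝ) ^ 2 * ((√q * Real.exp ((k + 1) / (2 * N))) ^ 2) ^ i) := by
  -- Reflecting `i ↦ k - i` makes the power of `q` and the tilt both grow with `i`, so they merge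
  -- into `ρ ^ (2 i)`.
  have hTS : ∑ i ∈ Finset.range (k + 1),
      (k.choose i : ℝ) ^ 2 * q ^ (k - i) * ∏ j ∈ Finset.range (k + 1), (N - i + j) =
      ∑ i ∈ Finset.range (k + 1), (k.choose i : ℝ) ^ 2 * q ^ i *
        ∏ j ∈ Finset.range (k + 1), (N - (k - i : ℕ) + j) := by
    rw [← Finset.sum_range_reflect]
    refine Finset.sum_congr rfl fun i hi => ?_
    have hik : i ≤ k := by have := Finset.mem_range.1 hi; omega
    rw [show k + 1 - 1 - i = k - i by omega, Nat.sub_sub_self hik, Nat.choose_symm hik]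
  have hterm : ∀ i ≤ k, (k.choose i : ℝ) ^ 2 * q ^ i * (N ^ (k + 1) *
      Real.exp ((k + 1) * (k - 2 * (k - i : ℕ)) / (2 * N))) =
      N ^ (k + 1) * (Real.exp (-((k + 1) / (2 * N) * k)) *
        ((k.choose i : ℝ) ^ 2 * ((√q * Real.exp ((k + 1) / (2 * N))) ^ 2) ^ i)) := by
    intro i hik
    have e1 : ((k : ℝ) + 1) * (k - 2 * (k - i : ℕ)) / (2 * N) =
        -((k + 1) / (2 * N) * k) + (2 * i : ℕ) * ((k + 1) / (2 * N)) := by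
      rw [Nat.cast_sub hik]
      push_cast
      field_simp
      ring
    rw [e1, Real.exp_add, Real.exp_nat_mul, mul_pow, Real.sq_sqrt h0, mul_pow,
      pow_mul (Real.exp _)]
    ring
  rw [hTS, Finset.mul_sum, Finset.mul_sum]
  constructor
  · rw [Finset.sum_mul]
    refine Finset.sum_le_sum fun i hi => ?_
    have hik : i ≤ k := by have := Finset.mem_range.1 hi; omega
    rw [← hterm i hik, mul_assoc]
    exact mul_le_mul_of_nonneg_left (exp_le_prod hN (Nat.sub_le k i) hkN) (by positivity)
  · refine Finset.sum_le_sum fun i hi => ?_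
    have hik : i ≤ k := by have := Finset.mem_range.1 hi; omega
    rw [← hterm i hik]
    exact mul_le_mul_of_nonneg_left (prod_le_exp hN (Nat.sub_le k i) hkN) (by positivity)

/-! ### Assembling the bounds -/

/-- Two-sided bounds for the tilted sums of squared binomial coefficients. -/
theorem tilted_sum_bounds {a e : ℝ} {k : ℕ} (ha1 : a ≤ 1) (he1 : 1 ≤ e) (he2 : e ≤ 2)
    (hka : 1 ≤ k * a) (ha0 : 0 < a) :
    (1 + a * e) ^ (2 * k) ≤ 18 * √(k * a) *
        ∑ i ∈ Finset.range (k + 1), (k.choose i : ℝ) ^ 2 * ((a * e) ^ 2) ^ i ∧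
      (∑ i ∈ Finset.range (k + 1), (k.choose i : ℝ) ^ 2 * ((a * e) ^ 2) ^ i) * √(k * a) ≤
        3 * (1 + a * e) ^ (2 * k) := by
  set ρ := a * e
  have hρ0 : 0 < ρ := by positivity
  have haρ : a ≤ ρ := le_mul_of_one_le_right ha0.le he1
  have hρa : ρ ≤ a * 2 := mul_le_mul_of_nonneg_left he2 ha0.le
  have hkρ : 1 ≤ k * ρ := hka.trans (by gcongr)
  have hu := sum_choose_sq_le k hρ0
  have hl := le_sum_choose_sq k hρ0 hkρ
  have hS0 : 0 ≤ ∑ i ∈ Finset.range (k + 1), (k.choose i : ℝ) ^ 2 * (ρ ^ 2) ^ i :=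
    Finset.sum_nonneg fun i _ => by positivity
  set S := ∑ i ∈ Finset.range (k + 1), (k.choose i : ℝ) ^ 2 * (ρ ^ 2) ^ i
  have htt : √(k * a) ^ 2 = k * a := Real.sq_sqrt (by linarith)
  have ht0 := Real.sqrt_nonneg (k * a)
  set t := √(k * a)
  constructor
  · have : √(k * ρ) ≤ 2 * t := by
      refine Real.sqrt_le_iff.2 ⟨by positivity, ?_⟩
      rw [mul_pow, htt]
      nlinarith
    calc _ ≤ _ := hl
      _ ≤ 9 * (2 * t) * S := by gcongr
      _ = _ := by ring
  · have hP : 0 ≤ (1 + ρ) ^ (2 * k) := by positivity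
    refine (pow_le_pow_iff_left₀ (by positivity) (by positivity) two_ne_zero).1 ?_
    -- This replaces `ρ` by `a` under the root; the leftover factor `1 + ρ` is at most `3` because
    -- `ρ ≤ 2 a ≤ 2`.
    have hkk : (k : ℝ) * a ≤ (k + 1) * (2 * ρ) := by
      have : (0 : ℝ) ≤ k := Nat.cast_nonneg k
      nlinarith
    calc (S * t) ^ 2 = S ^ 2 * (k * a) := by rw [mul_pow, htt]
      _ ≤ S ^ 2 * ((k + 1) * (2 * ρ)) := by gcongr
      _ ≤ ((1 + ρ) ^ (2 * k) * (1 + ρ)) ^ 2 := hu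
      _ ≤ ((1 + ρ) ^ (2 * k) * 3) ^ 2 := by
        gcongr
        linarith
      _ = _ := by ring

/-- Two-sided bounds for the right-hand side of Ledoux's formula. -/
theorem moment_bounds {q W : ℝ} (h1 : q < 1) {N k : ℕ} (hk : 0 < k) (hN : 0 < N)
    (hkN : (k : ℝ) / N ≤ 1 / 5) (hkW : (k : ℝ) ^ 3 ≤ W ^ 3 * N ^ 2) (hq : 1 / (k : ℝ) ^ 2 ≤ q) :
    (72 * Real.exp (4 * W ^ 3))⁻¹ * momentSize q N k ≤
        (N : ℝ)⁻¹ * ((k : ℝ) + 1)⁻¹ * (1 - q)⁻¹ ^ k * ∑ i ∈ Finset.range (k + 1),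
          (k.choose i : ℝ) ^ 2 * q ^ (k - i) * ∏ j ∈ Finset.range (k + 1), ((N : ℝ) - i + j) ∧
      (N : ℝ)⁻¹ * ((k : ℝ) + 1)⁻¹ * (1 - q)⁻¹ ^ k * ∑ i ∈ Finset.range (k + 1),
          (k.choose i : ℝ) ^ 2 * q ^ (k - i) * ∏ j ∈ Finset.range (k + 1), ((N : ℝ) - i + j) ≤
        72 * Real.exp (4 * W ^ 3) * momentSize q N k := by
  have hk1 : (1 : ℝ) ≤ k := by exact_mod_cast hk
  have hN' : (0 : ℝ) < N := by exact_mod_cast hN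
  have h0 : 0 < q := lt_of_lt_of_le (by positivity) hq
  have ha0 : 0 < √q := Real.sqrt_pos.2 h0
  have ha1 : √q < 1 := by rwa [Real.sqrt_lt' one_pos, one_pow]
  have hka : 1 ≤ k * √q := by
    have : 1 / (k : ℝ) ≤ √q := Real.le_sqrt_of_sq_le (by rwa [div_pow, one_pow])
    rwa [div_le_iff₀' (by linarith)] at this
  obtain ⟨hG1, hG2⟩ := tilt_bounds h0 h1 hN' hk hkN
  set s := ((k : ℝ) + 1) / (2 * N) with hs
  have hs0 : 0 ≤ s := by positivity
  have hsk : s ≤ k / N := by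
    rw [hs, div_le_div_iff₀ (by positivity) hN']
    nlinarith
  have hes : Real.exp s ≤ 2 := by
    refine (exp_le_one_add_add_sq (abs_le.2 ⟨by linarith, by linarith⟩)).trans ?_
    nlinarith
  have hes1 : 1 ≤ Real.exp s := Real.one_le_exp hs0
  -- The cubic error `k³/N²` is where the range `k ≤ W N ^ (2/3)` enters; both exponential errors
  -- below are multiples of it.
  have hcube : (k : ℝ) * (k / N) ^ 2 ≤ W ^ 3 := by
    rw [div_pow, ← mul_div_assoc, div_le_iff₀ (by positivity)]
    linarith
  have herr1 : 2 * ((k : ℝ) + 1) * (k / N) ^ 2 ≤ 4 * W ^ 3 := by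
    nlinarith [mul_nonneg (sub_nonneg.2 hk1) (sq_nonneg ((k : ℝ) / N))]
  have herr2 : 2 * k * s ^ 2 ≤ 4 * W ^ 3 := by
    have : s ^ 2 ≤ (k / N) ^ 2 := by gcongr
    nlinarith [mul_le_mul_of_nonneg_left this (by linarith : (0 : ℝ) ≤ k),
      mul_nonneg (by linarith : (0 : ℝ) ≤ k) (sq_nonneg ((k : ℝ) / N))]
  obtain ⟨hleT, hTle⟩ := ledoux_sum_bounds h0.le hN' hkN
  obtain ⟨hSl, hSu⟩ := tilted_sum_bounds ha1.le hes1 hes hka ha0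
  set ρ := √q * Real.exp s
  set S := ∑ i ∈ Finset.range (k + 1), (k.choose i : ℝ) ^ 2 * (ρ ^ 2) ^ i with hS
  set T := ∑ i ∈ Finset.range (k + 1),
    (k.choose i : ℝ) ^ 2 * q ^ (k - i) * ∏ j ∈ Finset.range (k + 1), ((N : ℝ) - i + j)
  have hS0 : 0 ≤ S := Finset.sum_nonneg fun i _ => by positivity
  have ht0 : 0 < √(k * √q) := Real.sqrt_pos.2 (by linarith)
  set t := √(k * √q)
  clear_value T S
  rw [momentSize_eq h0 hk]
  set B := (1 + √q) ^ (2 * k) * Real.exp (-((k : ℝ) ^ 2 / (2 * edge q * N)))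
  have hB : 0 < B := by positivity
  have h1q : 0 < (1 - q)⁻¹ := inv_pos.2 (by linarith)
  have hNk : (N : ℝ)⁻¹ * (N : ℝ) ^ (k + 1) = (N : ℝ) ^ k := by rw [pow_succ]; field_simp
  have hk2 : (2 * (k : ℝ))⁻¹ ≤ ((k : ℝ) + 1)⁻¹ := by gcongr; linarith
  have hk3 : ((k : ℝ) + 1)⁻¹ ≤ (k : ℝ)⁻¹ := by gcongr; linarith
  constructor
  · have hX : (Real.exp (4 * W ^ 3))⁻¹ ≤ Real.exp (-(2 * (k + 1) * (k / N) ^ 2)) := by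
      rw [← Real.exp_neg, Real.exp_le_exp]; linarith
    -- Here `36 = 2 * 18` combines the tilt and the binomial sum; bounding `k + 1` by `2 k` doubles
    -- it to `72`.
    have hBS : (36 * t)⁻¹ * B ≤ Real.exp (-(s * k)) * S := by
      rw [inv_mul_le_iff₀ (by positivity)]
      calc B ≤ _ := hG1
        _ ≤ 2 * ((18 * t * S) * Real.exp (-(s * k))) := by gcongr
        _ = _ := by ring
    calc (72 * Real.exp (4 * W ^ 3))⁻¹ * ((k * t)⁻¹ * ((N : ℝ) ^ k * (1 - q)⁻¹ ^ k * B))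
        = (N : ℝ)⁻¹ * (2 * (k : ℝ))⁻¹ * (1 - q)⁻¹ ^ k * ((N : ℝ) ^ (k + 1) *
          ((36 * t)⁻¹ * B) * (Real.exp (4 * W ^ 3))⁻¹) := by
          rw [← hNk]
          field_simp
          ring
      _ ≤ (N : ℝ)⁻¹ * ((k : ℝ) + 1)⁻¹ * (1 - q)⁻¹ ^ k * ((N : ℝ) ^ (k + 1) *
          (Real.exp (-(s * k)) * S) * Real.exp (-(2 * (k + 1) * (k / N) ^ 2))) := by gcongr
      _ ≤ _ := by
          refine mul_le_mul_of_nonneg_left ?_ (by positivity)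
          exact hleT
  · have hBS : Real.exp (-(s * k)) * S ≤ t⁻¹ * (3 * (B * Real.exp (4 * W ^ 3))) := by
      rw [le_inv_mul_iff₀ ht0]
      calc t * (Real.exp (-(s * k)) * S) = (S * t) * Real.exp (-(s * k)) := by ring
        _ ≤ (3 * (1 + ρ) ^ (2 * k)) * Real.exp (-(s * k)) := by gcongr
        _ = 3 * ((1 + ρ) ^ (2 * k) * Real.exp (-(s * k))) := by ring
        _ ≤ 3 * (B * Real.exp (2 * k * s ^ 2)) := by gcongr
        _ ≤ _ := by gcongr
    calc _ ≤ (N : ℝ)⁻¹ * (k : ℝ)⁻¹ * (1 - q)⁻¹ ^ k * ((N : ℝ) ^ (k + 1) *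
          (t⁻¹ * (3 * (B * Real.exp (4 * W ^ 3))))) := by
          have : T ≤ (N : ℝ) ^ (k + 1) * (t⁻¹ * (3 * (B * Real.exp (4 * W ^ 3)))) := by
            refine hTle.trans ?_
            gcongr
          have hpos : 0 ≤ (N : ℝ) ^ (k + 1) * (t⁻¹ * (3 * (B * Real.exp (4 * W ^ 3)))) := by
            positivity
          refine mul_le_mul ?_ this (le_trans (by positivity) hleT) (by positivity)
          gcongr
      _ = 3 * (Real.exp (4 * W ^ 3) * ((k * t)⁻¹ * ((N : ℝ) ^ k * (1 - q)⁻¹ ^ k * B))) := by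
          rw [← hNk, mul_inv]
          ring
      _ ≤ 72 * (Real.exp (4 * W ^ 3) * ((k * t)⁻¹ * ((N : ℝ) ^ k * (1 - q)⁻¹ ^ k * B))) := by
          gcongr
          norm_num
      _ = _ := by ring

theorem pow_three_le_of_le_rpow {W x N : ℝ} (hN : 0 ≤ N) (hx : 0 ≤ x)
    (h : x ≤ W * N ^ (2 / 3 : ℝ)) : x ^ 3 ≤ W ^ 3 * N ^ 2 := by
  refine (pow_le_pow_left₀ hx h 3).trans_eq ?_
  rw [mul_pow, ← Real.rpow_mul_natCast hN]
  norm_num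

end Meixner

end

theorem theoremt (W : ℝ) (hW : 0 < W) :
    ∃ C : ℝ, 0 < C ∧ ∃ N₀ k₀ : ℕ, 0 < N₀ ∧ 0 < k₀ ∧
      ∀ N k : ℕ, N₀ ≤ N → k₀ ≤ k → (k : ℝ) ≤ W * (N : ℝ) ^ (2 / 3 : ℝ) →
      ∀ q : unitInterval, 1 / (k : ℝ) ^ 2 ≤ (q : ℝ) → (q : ℝ) < 1 →
      ∀ Q : Measure (Fin N → ℕ), Meixner.IsEnsemble q N Q →
        Integrable (fun x : ℕ => (x.descFactorial k : ℝ)) (Meixner.meanEmpirical Q) ∧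
        C⁻¹ * Meixner.momentSize q N k ≤
          ∫ x : ℕ, (x.descFactorial k : ℝ) ∂(Meixner.meanEmpirical Q) ∧
        ∫ x : ℕ, (x.descFactorial k : ℝ) ∂(Meixner.meanEmpirical Q) ≤
          C * Meixner.momentSize q N k := by
  -- `N ≥ 125 W ^ 3` gives `(k / N) ^ 3 ≤ W ^ 3 / N ≤ (1/5) ^ 3`, the smallness required by the
  -- product estimates.
  refine ⟨72 * Real.exp (4 * W ^ 3), by positivity, ⌈125 * W ^ 3⌉₊ + 1, 1, Nat.succ_pos _, one_pos,
    fun N k hN hk hkW q hq h1 Q hQ => ?_⟩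
  have hN0 : 0 < N := by omega
  have hN' : (0 : ℝ) < N := by exact_mod_cast hN0
  have hcube := Meixner.pow_three_le_of_le_rpow hN'.le (Nat.cast_nonneg k) hkW
  have hNW : 125 * W ^ 3 ≤ N := (Nat.le_ceil _).trans (by exact_mod_cast (by omega))
  have hkN : (k : ℝ) / N ≤ 1 / 5 := by
    rw [div_le_iff₀ hN']
    refine le_of_pow_le_pow_left₀ three_ne_zero (by positivity) (hcube.trans ?_)
    nlinarith [mul_le_mul_of_nonneg_right hNW (sq_nonneg (N : ℝ))]
  have hlt : k < N := by
    have : (k : ℝ) < N := by rw [div_le_iff₀ hN'] at hkN; linarith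
    exact_mod_cast this
  have h0 : 0 < (q : ℝ) := lt_of_lt_of_le (by positivity) hq
  have := hQ.isProbabilityMeasure
  have := Meixner.isFiniteMeasure_meanEmpirical hN0 (Q := Q)
  obtain ⟨hint, heq⟩ := Meixner.integrable_and_integral_eq
    (fun x => Nat.cast_nonneg (x.descFactorial k))
    (Meixner.hasSum_descFactorial_meanEmpirical h0 h1 hlt hQ)
  obtain ⟨hlow, hup⟩ := Meixner.moment_bounds h1 hk hN0 hkN hcube hq
  rw [heq]
  exact ⟨hint, hlow, hup⟩
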